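/- Let $1\le k\le n$, let $p_1,\dots,p_n\in\mathbb{C}$ be distinct points, and let $\Sigma=\{(x,y)\in\mathbb{C}^2 : y^2=\prod_{j=1}^n(x-p_j)\}$, with projection $\pi(x,y)=x$, be the double cover of $\mathbb{C}$ branched at $p_1,\dots,p_n$; let $q_j=(p_j,0)$ be the unique point of $\pi^{-1}(p_j)$. The symmetric product $\mathrm{Sym}^k(\Sigma)=\Sigma^k/S_k$, with the quotient topology, is a $k$-dimensional complex manifold, with the complex structure for which a function on an open set $U$ is holomorphic if and only if its pullback to the preimage of $U$ in $\Sigma^k$ is holomorphic. With respect to this structure, the map $$f_{n,k}:\mathrm{Sym}^k(\Sigma)\to\mathbb{C},\qquad f_{n,k}([z_1,\dots,z_k])=\pi(z_1)+\dots+\pi(z_k),$$ is a Lefschetz fibration: it is holomorphic and surjective, it has finitely many critical points, and near each critical point there are holomorphic coordinates $w_1,\dots,w_k$, centred at that point, in which $f_{n,k}=\mathrm{const}+w_1^2+\dots+w_k^2$. Its critical points are exactly the $k$-tuples $[q_{j_1},\dots,q_{j_k}]$ of pairwise distinct points of $\{q_1,\dots,q_n\}$; there are $\binom nk$ of them, and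 each of them is nondegenerate (the complex Hessian of $f_{n,k}$ at the point, in any holomorphic chart, is a nondegenerate bilinear form). -/

import Mathlib

open scoped Manifold ContDiff Topology

noncomputable section

/-! ### The double cover of `ℂ` branched at `n` distinct points -/

/-- The polynomial function `x ↦ ∏ⱼ (x - pⱼ)`. -/
def branchPoly {n : ℕ} (p : Fin n ↪ ℂ) (x : ℂ) : ℂ := ∏ j, (x - p j)

/-- The double cover of `ℂ` branched at the distinct points `p₁, …, pₙ`, as the smooth affine curve
`y² = ∏ⱼ (x - pⱼ)` in `ℂ²`. -/
def DoubleCover {n : ℕ} (p : Fin n ↪ ℂ) : Type :=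
  {z : ℂ × ℂ // z.2 ^ 2 = branchPoly p z.1}

namespace DoubleCover

variable {n : ℕ} {p : Fin n ↪ ℂ}

instance : TopologicalSpace (DoubleCover p) :=
  inferInstanceAs (TopologicalSpace {z : ℂ × ℂ // z.2 ^ 2 = branchPoly p z.1})

/-- The covering map `π`, that is, the coordinate function `x`. -/
def proj (z : DoubleCover p) : ℂ := z.1.1

/-- The coordinate function `y`. -/
def snd (z : DoubleCover p) : ℂ := z.1.2

/-- The ramification point `qⱼ` over `pⱼ`. -/
def branchPoint (p : Fin n ↪ ℂ) (j : Fin n) : DoubleCover p :=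
  ⟨(p j, 0), by
    simp only [branchPoly]
    rw [Finset.prod_eq_zero (Finset.mem_univ j) (sub_self _)]
    simp⟩

theorem snd_sq (z : DoubleCover p) : z.snd ^ 2 = branchPoly p z.proj := z.2

@[ext] theorem ext {z w : DoubleCover p} (h1 : z.proj = w.proj) (h2 : z.snd = w.snd) : z = w :=
  Subtype.ext (Prod.ext h1 h2)

theorem continuous_proj : Continuous (proj (p := p)) :=
  continuous_fst.comp continuous_subtype_val

theorem continuous_snd : Continuous (snd (p := p)) :=
  _root_.continuous_snd.comp continuous_subtype_val

/-- `qⱼ` is the only point over `pⱼ`. -/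
theorem proj_eq_iff (z : DoubleCover p) (j : Fin n) : z.proj = p j ↔ z = branchPoint p j := by
  constructor
  · intro h
    have h2 := z.snd_sq
    rw [h, branchPoly, Finset.prod_eq_zero (Finset.mem_univ j) (sub_self _)] at h2
    exact DoubleCover.ext h (pow_eq_zero_iff two_ne_zero |>.1 h2)
  · rintro rfl; rfl

theorem contDiff_branchPoly (p : Fin n ↪ ℂ) : ContDiff ℂ ω (branchPoly p) := by
  unfold branchPoly
  exact contDiff_prod fun j _ => contDiff_id.sub contDiff_const

theorem deriv_branchPoly_ne_zero {x : ℂ} (hx : branchPoly p x = 0) :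
    deriv (branchPoly p) x ≠ 0 := by
  obtain ⟨j, -, hj⟩ := Finset.prod_eq_zero_iff.1 hx
  have hf : branchPoly p = fun x => (x - p j) * ∏ i ∈ Finset.univ.erase j, (x - p i) := by
    funext x
    exact (Finset.mul_prod_erase _ _ (Finset.mem_univ j)).symm
  have hd : DifferentiableAt ℂ (fun x : ℂ => ∏ i ∈ Finset.univ.erase j, (x - p i)) x := by
    fun_prop
  have h1 : HasDerivAt (fun x : ℂ => x - p j) 1 x := (hasDerivAt_id x).sub_const _
  have h2 := (h1.mul hd.hasDerivAt).deriv
  rw [hf]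
  change deriv (fun x => (x - p j) * ∏ i ∈ Finset.univ.erase j, (x - p i)) x = _ at h2
  rw [h2, hj]
  simp only [one_mul, zero_mul, add_zero]
  refine Finset.prod_ne_zero_iff.2 fun i hi h0 => (Finset.mem_erase.1 hi).1 (p.injective ?_)
  linear_combination hj - h0

/-- Near a point with `y = y₀ ≠ 0` the function `x` is a coordinate, and
`y = y₀ √(∏ⱼ (x - pⱼ) / y₀²)`. -/
def projChart (p : Fin n ↪ ℂ) (y₀ : ℂ) (hy : y₀ ≠ 0) :
    OpenPartialHomeomorph (DoubleCover p) ℂ where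
  toFun := proj
  invFun x := ⟨(x, y₀ * (branchPoly p x / y₀ ^ 2) ^ (1 / 2 : ℂ)), by
    have h : ((branchPoly p x / y₀ ^ 2) ^ (1 / 2 : ℂ)) ^ 2 = branchPoly p x / y₀ ^ 2 := by
      rw [← Complex.cpow_nat_mul]; simp
    simp only [mul_pow, h]
    field_simp⟩
  source := {z | 0 < (z.snd / y₀).re}
  target := {x | branchPoly p x / y₀ ^ 2 ∈ Complex.slitPlane}
  map_source' z hz := by
    simp only [Set.mem_ofPred_eq] at hz ⊢
    rw [← snd_sq, ← div_pow, Complex.mem_slitPlane_iff]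
    by_contra! h
    obtain ⟨h1, h2⟩ := h
    set w := z.snd / y₀
    have him : w.im = 0 := by
      have : 2 * w.re * w.im = 0 := by
        rw [sq, Complex.mul_im] at h2; linarith
      rcases mul_eq_zero.1 this with h | h
      · linarith
      · exact h
    rw [sq, Complex.mul_re, him] at h1
    nlinarith
  map_target' x hx := by
    simp only [Set.mem_ofPred_eq] at hx ⊢
    change 0 < (y₀ * (branchPoly p x / y₀ ^ 2) ^ (1 / 2 : ℂ) / y₀).re
    rw [mul_div_cancel_left₀ _ hy, Complex.cpow_def_of_ne_zero (Complex.slitPlane_ne_zero hx),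
      Complex.exp_re]
    refine mul_pos (Real.exp_pos _) (Real.cos_pos_of_mem_Ioo ?_)
    have him : (Complex.log (branchPoly p x / y₀ ^ 2) * (1 / 2)).im =
        Complex.arg (branchPoly p x / y₀ ^ 2) / 2 := by
      rw [show (1 / 2 : ℂ) = ((1 / 2 : ℝ) : ℂ) by push_cast; rfl, Complex.im_mul_ofReal,
        Complex.log_im]
      ring
    rw [him]
    have h1 := Complex.neg_pi_lt_arg (branchPoly p x / y₀ ^ 2)
    have h2 := Complex.arg_le_pi (branchPoly p x / y₀ ^ 2)
    have h3 := Complex.slitPlane_arg_ne_pi hx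
    have h4 := lt_of_le_of_ne h2 h3
    constructor <;> linarith
  left_inv' z hz := by
    refine DoubleCover.ext rfl ?_
    change y₀ * (branchPoly p z.proj / y₀ ^ 2) ^ (1 / 2 : ℂ) = z.snd
    simp only [Set.mem_ofPred_eq] at hz
    have hre := abs_lt.1 (Complex.abs_arg_lt_pi_div_two_iff.2 (Or.inl hz))
    rw [← snd_sq, ← div_pow, show (1 / 2 : ℂ) = ((2 : ℕ) : ℂ)⁻¹ by norm_num,
      Complex.pow_cpow_nat_inv two_ne_zero (by push_cast; exact hre.1)
        (by push_cast; exact hre.2.le)]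
    field_simp
  right_inv' x _ := rfl
  open_source := isOpen_lt continuous_const
    (Complex.continuous_re.comp (continuous_snd.div_const _))
  open_target := Complex.isOpen_slitPlane.preimage
    ((contDiff_branchPoly p).continuous.div_const _)
  continuousOn_toFun := continuous_proj.continuousOn
  continuousOn_invFun := by
    refine Topology.IsInducing.subtypeVal.continuousOn_iff.2
      (continuousOn_id.prodMk (continuousOn_const.mul ?_))
    exact ((contDiff_branchPoly p).continuous.div_const _).continuousOn.cpow_const
      fun x hx => hx

/-- The local inverse of `x ↦ ∏ⱼ (x - pⱼ)` at a root, on a set where the derivative is nonzero. -/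
def branchPolyInv (p : Fin n ↪ ℂ) (x₀ : ℂ) (hx : branchPoly p x₀ = 0) :
    OpenPartialHomeomorph ℂ ℂ :=
  (((contDiff_branchPoly p).contDiffAt.hasStrictDerivAt
    (by simp)).hasStrictFDerivAt_equiv (deriv_branchPoly_ne_zero hx)
      |>.toOpenPartialHomeomorph (branchPoly p)).restrOpen {x | deriv (branchPoly p) x ≠ 0}
        (isOpen_ne_fun ((contDiff_branchPoly p).continuous_deriv (by simp)) continuous_const)

theorem branchPolyInv_coe {x₀ : ℂ} (hx : branchPoly p x₀ = 0) :
    (branchPolyInv p x₀ hx : ℂ → ℂ) = branchPoly p := rfl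

theorem mem_branchPolyInv_source {x₀ : ℂ} (hx : branchPoly p x₀ = 0) :
    x₀ ∈ (branchPolyInv p x₀ hx).source :=
  ⟨HasStrictFDerivAt.mem_toOpenPartialHomeomorph_source _, deriv_branchPoly_ne_zero hx⟩

theorem contDiffOn_branchPolyInv_symm {x₀ : ℂ} (hx : branchPoly p x₀ = 0) :
    ContDiffOn ℂ ω (branchPolyInv p x₀ hx).symm (branchPolyInv p x₀ hx).target := by
  intro u hu
  have hs : deriv (branchPoly p) ((branchPolyInv p x₀ hx).symm u) ≠ 0 :=
    ((branchPolyInv p x₀ hx).map_target hu).2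
  refine ((branchPolyInv p x₀ hx).contDiffAt_symm_deriv hs hu ?_ ?_).contDiffWithinAt
  · rw [branchPolyInv_coe]
    exact ((contDiff_branchPoly p).differentiable (by simp) _).hasDerivAt
  · rw [branchPolyInv_coe]
    exact (contDiff_branchPoly p).contDiffAt

theorem branchPoly_branchPolyInv_symm {x₀ : ℂ} (hx : branchPoly p x₀ = 0) {u : ℂ}
    (hu : u ∈ (branchPolyInv p x₀ hx).target) :
    branchPoly p ((branchPolyInv p x₀ hx).symm u) = u :=
  (branchPolyInv p x₀ hx).right_inv hu

open Classical in
/-- The inverse of the function `y` near a point with `y = 0` and `x = x₀` (with a dummy value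
outside the domain). -/
def sndInv (p : Fin n ↪ ℂ) (x₀ : ℂ) (hx : branchPoly p x₀ = 0) (y : ℂ) : DoubleCover p :=
  if h : y ^ 2 ∈ (branchPolyInv p x₀ hx).target then
    ⟨((branchPolyInv p x₀ hx).symm (y ^ 2), y), (branchPoly_branchPolyInv_symm hx h).symm⟩
  else ⟨(x₀, 0), by simp [hx]⟩

theorem proj_sndInv {x₀ : ℂ} (hx : branchPoly p x₀ = 0) {y : ℂ}
    (hy : y ^ 2 ∈ (branchPolyInv p x₀ hx).target) :
    (sndInv p x₀ hx y).proj = (branchPolyInv p x₀ hx).symm (y ^ 2) := by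
  rw [show sndInv p x₀ hx y = ⟨((branchPolyInv p x₀ hx).symm (y ^ 2), y),
    (branchPoly_branchPolyInv_symm hx hy).symm⟩ from dif_pos hy]
  rfl

theorem snd_sndInv {x₀ : ℂ} (hx : branchPoly p x₀ = 0) {y : ℂ}
    (hy : y ^ 2 ∈ (branchPolyInv p x₀ hx).target) :
    (sndInv p x₀ hx y).snd = y := by
  rw [show sndInv p x₀ hx y = ⟨((branchPolyInv p x₀ hx).symm (y ^ 2), y),
    (branchPoly_branchPolyInv_symm hx hy).symm⟩ from dif_pos hy]
  rfl

/-- Near a point with `y = 0` the function `y` is a coordinate. -/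
def sndChart (p : Fin n ↪ ℂ) (x₀ : ℂ) (hx : branchPoly p x₀ = 0) :
    OpenPartialHomeomorph (DoubleCover p) ℂ where
  toFun := snd
  invFun := sndInv p x₀ hx
  source := {z | z.proj ∈ (branchPolyInv p x₀ hx).source}
  target := {y | y ^ 2 ∈ (branchPolyInv p x₀ hx).target}
  map_source' z hz := by
    simp only [Set.mem_ofPred_eq] at hz ⊢
    rw [snd_sq]
    exact (branchPolyInv p x₀ hx).map_source hz
  map_target' y hy := by
    simp only [Set.mem_ofPred_eq] at hy ⊢
    rw [proj_sndInv hx hy]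
    exact (branchPolyInv p x₀ hx).map_target hy
  left_inv' z hz := by
    have hy : z.snd ^ 2 ∈ (branchPolyInv p x₀ hx).target := by
      rw [snd_sq]
      exact (branchPolyInv p x₀ hx).map_source hz
    refine DoubleCover.ext ?_ (snd_sndInv hx hy)
    rw [proj_sndInv hx hy, snd_sq]
    exact (branchPolyInv p x₀ hx).left_inv hz
  right_inv' y hy := snd_sndInv hx hy
  open_source := (branchPolyInv p x₀ hx).open_source.preimage continuous_proj
  open_target := (branchPolyInv p x₀ hx).open_target.preimage (by fun_prop)
  continuousOn_toFun := continuous_snd.continuousOn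
  continuousOn_invFun := by
    refine Topology.IsInducing.subtypeVal.continuousOn_iff.2 ?_
    have : ContinuousOn (fun y : ℂ => ((branchPolyInv p x₀ hx).symm (y ^ 2), y))
        {y | y ^ 2 ∈ (branchPolyInv p x₀ hx).target} := by
      refine ContinuousOn.prodMk ?_ continuousOn_id
      exact (branchPolyInv p x₀ hx).continuousOn_symm.comp (by fun_prop) fun y hy => hy
    exact this.congr fun y hy => Prod.ext (proj_sndInv hx hy) (snd_sndInv hx hy)

open Classical in
/-- The coordinate near `z`: the function `x` if `z` is not a ramification point, and the
function `y` if it is. -/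
def chart (z : DoubleCover p) : OpenPartialHomeomorph (DoubleCover p) ℂ :=
  if h : z.snd = 0 then sndChart p z.proj (by rw [← snd_sq, h]; simp) else projChart p z.snd h

instance : ChartedSpace ℂ (DoubleCover p) where
  atlas := Set.range chart
  chartAt := chart
  mem_chart_source z := by
    unfold chart
    split_ifs with h
    · exact mem_branchPolyInv_source (p := p) (x₀ := z.proj) (by rw [← snd_sq, h]; simp)
    · change 0 < (z.snd / z.snd).re
      simp [div_self h]
  chart_mem_atlas z := ⟨z, rfl⟩

theorem contDiffOn_proj_chart_symm (z : DoubleCover p) :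
    ContDiffOn ℂ ω (fun u => ((chart z).symm u).proj) (chart z).target := by
  unfold chart
  split_ifs with h
  · have h0 : branchPoly p z.proj = 0 := by rw [← snd_sq, h]; simp
    have : ContDiffOn ℂ ω (fun y : ℂ => (branchPolyInv p z.proj h0).symm (y ^ 2))
        {y | y ^ 2 ∈ (branchPolyInv p z.proj h0).target} :=
      (contDiffOn_branchPolyInv_symm h0).comp (by fun_prop) fun y hy => hy
    exact this.congr fun y hy => proj_sndInv h0 hy
  · exact contDiffOn_id

theorem contDiffOn_snd_chart_symm (z : DoubleCover p) :
    ContDiffOn ℂ ω (fun u => ((chart z).symm u).snd) (chart z).target := by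
  unfold chart
  split_ifs with h
  · have h0 : branchPoly p z.proj = 0 := by rw [← snd_sq, h]; simp
    exact contDiffOn_id.congr fun y hy => snd_sndInv h0 hy
  · change ContDiffOn ℂ ω
      (fun x => z.snd * (branchPoly p x / z.snd ^ 2) ^ (1 / 2 : ℂ)) _
    intro x hx
    change branchPoly p x / z.snd ^ 2 ∈ Complex.slitPlane at hx
    refine (contDiffAt_const.mul ?_).contDiffWithinAt
    have h1 : AnalyticAt ℂ (branchPoly p) x :=
      (contDiff_branchPoly p).contDiffAt.analyticAt
    exact ((h1.div analyticAt_const (pow_ne_zero 2 h)).cpow analyticAt_const hx).contDiffAt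

/-- The double cover is a Riemann surface. -/
instance : IsManifold 𝓘(ℂ, ℂ) ω (DoubleCover p) := by
  refine isManifold_of_contDiffOn _ _ _ ?_
  rintro _ _ ⟨z, rfl⟩ ⟨w, rfl⟩
  simp only [modelWithCornersSelf_coe, modelWithCornersSelf_coe_symm, Set.preimage_id_eq,
    Set.range_id, Set.inter_univ, Function.id_comp, Function.comp_id, id]
  have hsub : ((chart z).symm.trans (chart w)).source ⊆ (chart z).target := fun u hu => hu.1
  by_cases h : w.snd = 0
  · refine ((contDiffOn_snd_chart_symm z).mono hsub).congr fun u _ => ?_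
    rw [show chart w = sndChart p w.proj (by rw [← snd_sq, h]; simp) from dif_pos h]
    rfl
  · refine ((contDiffOn_proj_chart_symm z).mono hsub).congr fun u _ => ?_
    rw [show chart w = projChart p w.snd h from dif_neg h]
    rfl

end DoubleCover

/-! ### Symmetric products of a Riemann surface -/

/-- The quotient map `X^k → Sym^k(X)`, `(z₁, …, z_k) ↦ [z₁, …, z_k]`. -/
def symMk {X : Type*} {k : ℕ} (v : Fin k → X) : Sym X k :=
  ⟨Finset.univ.val.map v, by simp⟩

/-- `Sym^k(X)` carries the quotient topology of `X^k`. -/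
instance Sym.instQuotientTopology {X : Type*} [TopologicalSpace X] {k : ℕ} :
    TopologicalSpace (Sym X k) :=
  TopologicalSpace.coinduced symMk inferInstance

/-- The complex manifold structure of `Sym^k(X)` induced by the product structure of `X^k`, for a
Riemann surface `X`: `Sym^k(X)` is a `k`-dimensional complex manifold whose holomorphic functions
on an open set `U` are exactly the functions whose pullback to the preimage of `U` in `X^k` is
holomorphic. The last condition determines the maximal atlas. -/
structure IsSymComplexStructure {X : Type*} [TopologicalSpace X] [ChartedSpace ℂ X] {k : ℕ}
    (cs : ChartedSpace (Fin k → ℂ) (Sym X k)) : Prop where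
  isManifold : IsManifold 𝓘(ℂ, Fin k → ℂ) ω (Sym X k)
  contMDiffOn_iff : ∀ (U : Set (Sym X k)), IsOpen U → ∀ g : Sym X k → ℂ,
    ContMDiffOn 𝓘(ℂ, Fin k → ℂ) 𝓘(ℂ, ℂ) ω g U ↔
      ContMDiffOn (ModelWithCorners.pi fun _ : Fin k => 𝓘(ℂ, ℂ)) 𝓘(ℂ, ℂ) ω
        (g ∘ symMk) (symMk ⁻¹' U)

/-! ### Lefschetz fibrations over `ℂ` -/

section Lefschetz

variable (k : ℕ) {M : Type*} [TopologicalSpace M] [ChartedSpace (Fin k → ℂ) M]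

/-- The critical points of a function on a `k`-dimensional complex manifold. -/
def criticalSet (f : M → ℂ) : Set M :=
  {z | mfderiv 𝓘(ℂ, Fin k → ℂ) 𝓘(ℂ, ℂ) f z = 0}

/-- A critical point is nondegenerate if the complex Hessian, in any holomorphic chart, is a
nondegenerate bilinear form. -/
def IsNondegenerateCriticalPoint (f : M → ℂ) (z : M) : Prop :=
  z ∈ criticalSet k f ∧
    ∀ e ∈ IsManifold.maximalAtlas 𝓘(ℂ, Fin k → ℂ) ω M, z ∈ e.source →
      ∀ u : Fin k → ℂ,
        (∀ v : Fin k → ℂ, fderiv ℂ (fderiv ℂ (f ∘ e.symm)) (e z) u v = 0) → u = 0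

/-- A Lefschetz fibration over `ℂ`: a surjective holomorphic map with finitely many critical
points, near each of which there are holomorphic coordinates `w₁, …, w_k`, centred at the
critical point, such that `f = const + w₁² + ⋯ + w_k²`. -/
structure IsLefschetzFibration (f : M → ℂ) : Prop where
  isManifold : IsManifold 𝓘(ℂ, Fin k → ℂ) ω M
  holomorphic : ContMDiff 𝓘(ℂ, Fin k → ℂ) 𝓘(ℂ, ℂ) ω f
  surjective : Function.Surjective f
  finite_criticalSet : (criticalSet k f).Finite
  local_model : ∀ z ∈ criticalSet k f,
    ∃ e ∈ IsManifold.maximalAtlas 𝓘(ℂ, Fin k → ℂ) ω M, z ∈ e.source ∧ e z = 0 ∧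
      ∀ x ∈ e.source, f x = f z + ∑ i, e x i ^ 2

end Lefschetz

/-- The map `f_{n,k} : Sym^k(Σ) → ℂ`, `[z₁, …, z_k] ↦ π(z₁) + ⋯ + π(z_k)`. -/
def symProjSum {n : ℕ} (p : Fin n ↪ ℂ) (k : ℕ) (z : Sym (DoubleCover p) k) : ℂ :=
  ((z : Multiset (DoubleCover p)).map DoubleCover.proj).sum

end

noncomputable section

open Set Filter

/-! ### Points and topology of the symmetric product -/

section SymMk

variable {X Y : Type*} {k : ℕ}

/-! The complex structure on `Sym X k` comes from charts `symChart e`. Any finite set of points lies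
in the domain of one chart `e` of `X` (`exists_chart_of_finite`), and the elementary symmetric
functions of the `e`-coordinates identify unordered tuples with an open subset of `ℂ^k`
(`symEsymmHomeomorph`). Compatibility of these charts and the description of their holomorphic
functions both rest on `analyticAt_of_comp_esymmMap`: a function of `(e₁, …, e_k)` is holomorphic if
its pullback to the roots is. There the Cauchy kernel is averaged over permutations. The result is
rational in the elementary symmetric functions, with coefficients in the Banach algebra of
continuous functions on a parameter box for the torus, and integrating it recovers the function.

Everything about the fibration uses only the two defining properties of the structure, so it applies
to every admissible atlas. If an entry of a tuple is unramified, moving it alone changes the sum to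
first order, so the tuple is not critical. If two entries coincide at `qⱼ`, move them to parameters
`s` and `-s` with `x = pⱼ + s²`. The unordered tuple is even in `s`, hence moves by `O(s²)`, while
the sum changes by `2s²`; a vanishing derivative would give `o(s²)`. So critical tuples consist of
distinct ramification points.

Conversely, near distinct points the coordinates of the factors are coordinates of the symmetric
product (`prodChart`). With the coordinates `√(x - pⱼ)` the sum becomes a constant plus a sum of
squares (`exists_morse_chart`). Such a chart makes its centre critical, and comparison with an
arbitrary chart gives nondegeneracy. Critical points then correspond to `k`-element subsets of the
`n` branch points. -/

theorem symMk_surjective : Function.Surjective (symMk : (Fin k → X) → Sym X k) := by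
  rintro ⟨m, hm⟩
  induction m using Quotient.inductionOn with
  | h l =>
    have hl : l.length = k := hm
    subst hl
    refine ⟨l.get, Subtype.ext ?_⟩
    change Finset.univ.val.map l.get = (l : Multiset X)
    rw [Fin.univ_val_map, List.ofFn_get]

theorem mem_symMk {v : Fin k → X} {x : X} : x ∈ symMk v ↔ ∃ i, v i = x := by
  change x ∈ Finset.univ.val.map v ↔ _
  simp

theorem forall_mem_symMk {v : Fin k → X} {q : X → Prop} :
    (∀ x ∈ symMk v, q x) ↔ ∀ i, q (v i) := by
  simp [mem_symMk]

theorem map_symMk (f : X → Y) (v : Fin k → X) : (symMk v).map f = symMk (f ∘ v) :=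
  Subtype.ext (Multiset.map_map f v Finset.univ.val)

theorem symMk_comp_perm (v : Fin k → X) (σ : Equiv.Perm (Fin k)) : symMk (v ∘ σ) = symMk v := by
  refine Subtype.ext ?_
  change Finset.univ.val.map (v ∘ σ) = Finset.univ.val.map v
  rw [← Multiset.map_map, Multiset.map_univ_val_equiv]

/-- Equal multisets have equal multiplicities, so the fibres of `v` and `w` over each point have the
same size; bijections between the fibres glue to `σ`. -/
theorem symMk_eq_symMk_iff {v w : Fin k → X} :
    symMk v = symMk w ↔ ∃ σ : Equiv.Perm (Fin k), v = w ∘ σ := by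
  classical
  constructor
  · intro h
    have h' : Finset.univ.val.map v = Finset.univ.val.map w := congrArg Subtype.val h
    have hc : ∀ x : X, Fintype.card {i // v i = x} = Fintype.card {i // w i = x} := by
      intro x
      have := congrArg (Multiset.count x) h'
      rw [Multiset.count_map, Multiset.count_map] at this
      simp only [Fintype.card_subtype, Finset.card, Finset.filter_val]
      simpa only [eq_comm] using this
    refine ⟨Equiv.ofFiberEquiv fun x => Fintype.equivOfCardEq (hc x), ?_⟩
    funext i
    exact (Equiv.ofFiberEquiv_map _ i).symm
  · rintro ⟨σ, rfl⟩
    exact symMk_comp_perm w σ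

variable [TopologicalSpace X] [TopologicalSpace Y]

theorem continuous_symMk : Continuous (symMk : (Fin k → X) → Sym X k) :=
  continuous_coinduced_rng

theorem isOpen_sym_iff {U : Set (Sym X k)} : IsOpen U ↔ IsOpen (symMk ⁻¹' U) :=
  isOpen_coinduced

/-- The saturation of an open set is the union of its permuted copies. -/
theorem isOpenMap_symMk : IsOpenMap (symMk : (Fin k → X) → Sym X k) := by
  intro U hU
  rw [isOpen_sym_iff]
  have : symMk ⁻¹' (symMk '' U) = ⋃ σ : Equiv.Perm (Fin k), (fun v : Fin k → X => v ∘ σ) ⁻¹' U := by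
    ext v
    simp only [mem_preimage, mem_image, mem_iUnion]
    constructor
    · rintro ⟨w, hw, h⟩
      obtain ⟨σ, rfl⟩ := symMk_eq_symMk_iff.1 h
      exact ⟨σ, hw⟩
    · rintro ⟨σ, h⟩
      exact ⟨_, h, symMk_comp_perm v σ⟩
  rw [this]
  exact isOpen_iUnion fun σ => hU.preimage (by fun_prop)

theorem isOpenQuotientMap_symMk : IsOpenQuotientMap (symMk : (Fin k → X) → Sym X k) :=
  ⟨symMk_surjective, continuous_symMk, isOpenMap_symMk⟩

theorem continuousOn_sym_iff {U : Set (Sym X k)} (hU : IsOpen U) {f : Sym X k → Y} :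
    ContinuousOn f U ↔ ContinuousOn (f ∘ symMk) (symMk ⁻¹' U) := by
  refine ⟨fun h => h.comp continuous_symMk.continuousOn (mapsTo_preimage _ _), fun h z hz => ?_⟩
  obtain ⟨v, rfl⟩ := symMk_surjective z
  have h1 : ContinuousAt (f ∘ symMk) v :=
    h.continuousAt ((hU.preimage continuous_symMk).mem_nhds hz)
  exact (isOpenQuotientMap_symMk.continuousAt_comp_iff.1 h1).continuousWithinAt

end SymMk

/-! ### Elementary symmetric functions as coordinates on `Sym^k(ℂ)` -/

section Esymm

variable {k : ℕ}

/-- The elementary symmetric functions `e₁, …, e_k` of a `k`-tuple. -/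
def esymmMap (k : ℕ) (t : Fin k → ℂ) (i : Fin k) : ℂ :=
  MvPolynomial.aeval t (MvPolynomial.esymm (Fin k) ℂ (i + 1))

/-- The elementary symmetric functions on the symmetric product. -/
def symEsymm (k : ℕ) (z : Sym ℂ k) (i : Fin k) : ℂ := (z : Multiset ℂ).esymm (i + 1)

theorem symEsymm_symMk (t : Fin k → ℂ) : symEsymm k (symMk t) = esymmMap k t :=
  funext fun i => (MvPolynomial.aeval_esymm_eq_multiset_esymm (Fin k) ℂ (i + 1) t).symm

theorem analyticAt_esymmMap (t : Fin k → ℂ) : AnalyticAt ℂ (esymmMap k) t := by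
  refine AnalyticAt.pi fun i => ?_
  exact AnalyticAt.aeval_mvPolynomial (f := fun t : Fin k → ℂ => t)
    (fun j => (ContinuousLinearMap.proj (R := ℂ) (φ := fun _ : Fin k => ℂ) j).analyticAt t) _

theorem continuous_esymmMap : Continuous (esymmMap k) :=
  continuous_iff_continuousAt.2 fun t => (analyticAt_esymmMap t).continuousAt

/-- Up to sign the values are the coefficients of `∏ (X - t)`, whose roots give back the multiset.
-/
theorem symEsymm_injective : Function.Injective (symEsymm k) := by
  intro z w h
  have he : ∀ j ≤ k, (z : Multiset ℂ).esymm j = (w : Multiset ℂ).esymm j := by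
    rintro (_ | j) hj
    · simp [Multiset.esymm]
    · exact congrFun h ⟨j, hj⟩
  have hp : ((z : Multiset ℂ).map fun t => Polynomial.X - Polynomial.C t).prod =
      ((w : Multiset ℂ).map fun t => Polynomial.X - Polynomial.C t).prod := by
    rw [Multiset.prod_X_sub_X_eq_sum_esymm, Multiset.prod_X_sub_X_eq_sum_esymm]
    have hz : Multiset.card (z : Multiset ℂ) = k := z.2
    have hw : Multiset.card (w : Multiset ℂ) = k := w.2
    rw [hz, hw]
    refine Finset.sum_congr rfl fun j hj => ?_
    rw [he j (by simpa [Nat.lt_succ_iff] using hj)]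
  have := congrArg Polynomial.roots hp
  rw [Polynomial.roots_multiset_prod_X_sub_C, Polynomial.roots_multiset_prod_X_sub_C] at this
  exact Subtype.ext this

/-- Since `ℂ` is algebraically closed, the monic polynomial with the prescribed coefficients has `k`
roots, and Vieta's formulas apply. -/
theorem symEsymm_surjective : Function.Surjective (symEsymm k) := by
  intro c
  -- By Vieta, the coefficient of `X^(k-1-i)` in `∏ (X - t)` is `(-1)^(i+1) e_{i+1}`; the index `i`
  -- of `c` starts at `0`.
  set q : Polynomial ℂ := ∑ i : Fin k, Polynomial.C ((-1) ^ (i + 1 : ℕ) * c i) *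
    Polynomial.X ^ (k - 1 - i : ℕ) with hq
  have hdeg : q.degree < k := by
    refine (Polynomial.degree_sum_le _ _).trans_lt ?_
    refine (Finset.sup_lt_iff (WithBot.bot_lt_coe k)).2 fun i _ => ?_
    refine (Polynomial.degree_C_mul_X_pow_le _ _).trans_lt ?_
    exact WithBot.coe_lt_coe.2 (show k - 1 - (i : ℕ) < k by omega)
  set P : Polynomial ℂ := Polynomial.X ^ k + q with hP
  have hm : P.Monic := Polynomial.monic_X_pow_add hdeg
  have hnd : P.natDegree = k := by
    rw [hP, add_comm]
    have := Polynomial.natDegree_add_eq_right_of_degree_lt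
      (p := q) (q := (Polynomial.X : Polynomial ℂ) ^ k) (by simpa using hdeg)
    rw [this, Polynomial.natDegree_X_pow]
  have hcard : Multiset.card P.roots = k := by
    rw [← (IsAlgClosed.splits P).natDegree_eq_card_roots, hnd]
  refine ⟨⟨P.roots, hcard⟩, funext fun i => ?_⟩
  change P.roots.esymm (i + 1) = c i
  have h1 := Polynomial.coeff_eq_esymm_roots_of_splits (IsAlgClosed.splits P)
    (k := k - 1 - i) (by omega)
  rw [hnd, hm.leadingCoeff, one_mul, show k - (k - 1 - i) = i + 1 by omega] at h1
  have h2 : P.coeff (k - 1 - i) = (-1) ^ (i + 1 : ℕ) * c i := by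
    rw [hP, Polynomial.coeff_add, Polynomial.coeff_X_pow, if_neg (by omega), zero_add, hq,
      Polynomial.finsetSum_coeff, Finset.sum_eq_single i]
    · rw [Polynomial.coeff_C_mul_X_pow, if_pos rfl]
    · intro j _ hj
      rw [Polynomial.coeff_C_mul_X_pow, if_neg]
      intro h
      exact hj (Fin.ext (by omega))
    · simp
  rw [h2] at h1
  exact (mul_left_cancel₀ (pow_ne_zero _ (by norm_num)) h1).symm

/-- A root of a monic polynomial is bounded in terms of the coefficients. -/
theorem norm_le_of_esymmMap (t : Fin k → ℂ) : ‖t‖ ≤ 1 + k * ‖esymmMap k t‖ := by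
  have hpos : 0 ≤ 1 + k * ‖esymmMap k t‖ := by positivity
  refine (pi_norm_le_iff_of_nonneg hpos).2 fun i => ?_
  -- For a root of norm greater than `1`, solve the equation for `(t i)^k`: each of the `k` other
  -- terms is at most `‖esymmMap k t‖ * ‖t i‖^(k-1)`, and that power can be cancelled.
  by_cases h1 : ‖t i‖ ≤ 1
  · exact h1.trans (by nlinarith [norm_nonneg (esymmMap k t), Nat.cast_nonneg (α := ℝ) k])
  push Not at h1
  set s : Multiset ℂ := Finset.univ.val.map t with hs
  have hcard : Multiset.card s = k := by simp [hs]
  have h0 : Polynomial.eval (t i) (s.map fun t => Polynomial.X - Polynomial.C t).prod = 0 := by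
    rw [Polynomial.eval_multiset_prod, Multiset.map_map]
    refine Multiset.prod_eq_zero (Multiset.mem_map.2 ⟨t i, ?_, by simp⟩)
    simp [hs]
  rw [Multiset.prod_X_sub_X_eq_sum_esymm, hcard, Finset.sum_range_succ',
    Polynomial.eval_add, Polynomial.eval_finsetSum] at h0
  have h2 : (t i) ^ k = -∑ j ∈ Finset.range k, (-1) ^ (j + 1) *
      (s.esymm (j + 1) * (t i) ^ (k - (j + 1))) := by
    simp only [Polynomial.eval_mul, Polynomial.eval_pow, Polynomial.eval_neg, Polynomial.eval_one,
      Polynomial.eval_C, Polynomial.eval_X] at h0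
    rw [eq_neg_iff_add_eq_zero, add_comm, ← h0]
    simp [Multiset.esymm]
  have hk : 0 < k := i.pos
  have h3 : ‖t i‖ ^ k ≤ k * ‖esymmMap k t‖ * ‖t i‖ ^ (k - 1) := by
    rw [← norm_pow, h2, norm_neg]
    refine (norm_sum_le _ _).trans ?_
    have : ∀ j ∈ Finset.range k, ‖(-1 : ℂ) ^ (j + 1) * (s.esymm (j + 1) * (t i) ^ (k - (j + 1)))‖ ≤
        ‖esymmMap k t‖ * ‖t i‖ ^ (k - 1) := by
      intro j hj
      rw [norm_mul, norm_pow, norm_neg, norm_one, one_pow, one_mul, norm_mul, norm_pow]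
      refine mul_le_mul ?_ (pow_le_pow_right₀ h1.le (by omega)) (by positivity) (norm_nonneg _)
      rw [← symEsymm_symMk]
      exact norm_le_pi_norm (symEsymm k (symMk t)) ⟨j, Finset.mem_range.1 hj⟩
    refine (Finset.sum_le_card_nsmul _ _ _ this).trans_eq ?_
    rw [Finset.card_range, nsmul_eq_mul, mul_assoc]
  have h4 : ‖t i‖ ≤ k * ‖esymmMap k t‖ := by
    have hp : 0 < ‖t i‖ ^ (k - 1) := by positivity
    refine le_of_mul_le_mul_right ?_ hp
    rwa [← pow_succ', Nat.sub_add_cancel hk]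
  linarith

/-- The root bound shows that the roots stay bounded while the coefficients do. Properness makes the
map closed, which is what gives continuity of the inverse of `symEsymm`. -/
theorem isProperMap_esymmMap : IsProperMap (esymmMap k) := by
  refine isProperMap_iff_tendsto_cocompact.2 ⟨continuous_esymmMap, ?_⟩
  rw [← Metric.cobounded_eq_cocompact, ← tendsto_norm_atTop_iff_cobounded]
  have h := tendsto_norm_cobounded_atTop (E := Fin k → ℂ)
  rw [tendsto_atTop] at h ⊢
  intro b
  filter_upwards [h (1 + k * b + 1)] with t ht
  have h1 := norm_le_of_esymmMap t
  by_contra! hb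
  have : (k : ℝ) * ‖esymmMap k t‖ ≤ k * b := by gcongr
  linarith

/-- `Sym^k(ℂ)` is homeomorphic to `ℂ^k` by the elementary symmetric functions. -/
def symEsymmHomeomorph (k : ℕ) : Sym ℂ k ≃ₜ (Fin k → ℂ) :=
  (Equiv.ofBijective (symEsymm k)
    ⟨symEsymm_injective, symEsymm_surjective⟩).toHomeomorphOfContinuousClosed
    (by
      refine isOpenQuotientMap_symMk.isQuotientMap.continuous_iff.2 ?_
      exact continuous_esymmMap.congr fun t => (symEsymm_symMk t).symm)
    (by
      intro F hF
      have : symEsymm k '' F = esymmMap k '' (symMk ⁻¹' F) := by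
        rw [← image_preimage_eq F symMk_surjective, image_image,
          image_preimage_eq F symMk_surjective]
        exact image_congr fun t _ => symEsymm_symMk t
      change IsClosed (symEsymm k '' F)
      rw [this]
      exact isProperMap_esymmMap.isClosedMap _ (hF.preimage continuous_symMk))

theorem symEsymmHomeomorph_symMk (t : Fin k → ℂ) :
    symEsymmHomeomorph k (symMk t) = esymmMap k t := symEsymm_symMk t

theorem isOpenQuotientMap_esymmMap : IsOpenQuotientMap (esymmMap k) := by
  have : esymmMap k = symEsymmHomeomorph k ∘ symMk :=
    funext fun t => (symEsymmHomeomorph_symMk t).symm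
  rw [this]
  exact (symEsymmHomeomorph k).isOpenQuotientMap.comp isOpenQuotientMap_symMk

theorem esymmMap_comp_perm (t : Fin k → ℂ) (σ : Equiv.Perm (Fin k)) :
    esymmMap k (t ∘ σ) = esymmMap k t := by
  rw [← symEsymmHomeomorph_symMk, symMk_comp_perm, symEsymmHomeomorph_symMk]

end Esymm

/-! ### The Cauchy integral formula on a polydisc -/

section Torus

open Complex MeasureTheory Metric

theorem torusMap_mem_sphere {k : ℕ} {c : Fin k → ℂ} {R : Fin k → ℝ} (hR : ∀ i, 0 < R i)
    (θ : Fin k → ℝ) (i : Fin k) : torusMap c R θ i ∈ sphere (c i) (R i) := by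
  simp [torusMap, abs_of_pos (hR i)]

theorem continuous_torusMap {k : ℕ} (c : Fin k → ℂ) (R : Fin k → ℝ) :
    Continuous (torusMap c R) := by
  unfold torusMap
  fun_prop

/-- The Cauchy integral formula for a polydisc; the integral vanishes if some coordinate of the
parameter lies outside the corresponding closed disc. -/
theorem torusIntegral_cauchy {k : ℕ} (c : Fin k → ℂ) (R : Fin k → ℝ) (hR : ∀ i, 0 < R i)
    (f : (Fin k → ℂ) → ℂ)
    (hf : ∀ z, (∀ i, z i ∈ closedBall (c i) (R i)) → DifferentiableAt ℂ f z)
    (t : Fin k → ℂ) (ht : ∀ i, t i ∉ sphere (c i) (R i)) [Decidable (∀ i, t i ∈ ball (c i) (R i))] :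
    (∯ z in T(c, R), (∏ i, (z i - t i)⁻¹) * f z) =
      if ∀ i, t i ∈ ball (c i) (R i) then (2 * Real.pi * I) ^ k * f t else 0 := by
  classical
  induction k with
  | zero =>
    rw [torusIntegral_dim0, if_pos (fun i => i.elim0)]
    simp [Subsingleton.elim c t]
  | succ k ih =>
    have hint : TorusIntegrable (fun z => (∏ i, (z i - t i)⁻¹) * f z) c R := by
      refine ContinuousOn.integrableOn_compact isCompact_Icc (Continuous.continuousOn ?_)
      refine Continuous.mul (continuous_finsetProd _ fun i _ => Continuous.inv₀ ?_ ?_) ?_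
      · exact ((continuous_apply i).comp (continuous_torusMap c R)).sub continuous_const
      · intro θ h
        have := torusMap_mem_sphere (c := c) hR θ i
        rw [sub_eq_zero.1 h] at this
        exact ht i this
      · refine continuous_iff_continuousAt.2 fun θ => ?_
        exact ContinuousAt.comp (f := torusMap c R) (hf _ fun i => sphere_subset_closedBall
          (torusMap_mem_sphere hR θ i)).continuousAt (continuous_torusMap c R).continuousAt
    rw [torusIntegral_succ hint]
    set t' : Fin k → ℂ := fun i => t i.succ with ht'
    have hcons : ∀ x ∈ closedBall (c 0) (R 0), ∀ y : Fin k → ℂ,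
        (∀ i, y i ∈ closedBall (c i.succ) (R i.succ)) →
        DifferentiableAt ℂ f (Fin.cons x y : Fin (k + 1) → ℂ) := by
      intro x hx y hy
      refine hf _ fun i => ?_
      refine Fin.cases ?_ (fun i => ?_) i
      · simpa using hx
      · simpa using hy i
    have hd1 : ∀ y : Fin k → ℂ, Differentiable ℂ fun x : ℂ => (Fin.cons x y : Fin (k + 1) → ℂ) := by
      intro y
      refine differentiable_pi.2 fun i => ?_
      refine Fin.cases ?_ (fun i => ?_) i
      · simp
      · simp
    have hd2 : ∀ x : ℂ, Differentiable ℂ fun y : Fin k → ℂ => (Fin.cons x y : Fin (k + 1) → ℂ) := by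
      intro x
      refine differentiable_pi.2 fun i => ?_
      refine Fin.cases ?_ (fun i => ?_) i
      · simp
      · simpa using differentiable_apply i
    have hinner : ∀ x ∈ closedBall (c 0) (R 0),
        (∯ y in T(c ∘ Fin.succ, R ∘ Fin.succ),
          (∏ i, ((Fin.cons x y : Fin (k + 1) → ℂ) i - t i)⁻¹) * f (Fin.cons x y)) =
        (x - t 0)⁻¹ * if ∀ i, t' i ∈ ball (c i.succ) (R i.succ) then
          (2 * Real.pi * I) ^ k * f (Fin.cons x t') else 0 := by
      intro x hx
      have := ih (c ∘ Fin.succ) (R ∘ Fin.succ) (fun i => hR _) (fun y => f (Fin.cons x y))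
        (fun y hy => (hcons x hx y hy).comp y (hd2 x y)) t' (fun i => ht _)
      simp only [Function.comp_apply] at this
      rw [← this, ← torusIntegral_const_mul]
      congr 1
      funext y
      rw [Fin.prod_univ_succ]
      simp [mul_assoc, ht']
    have hsphere : EqOn (fun x => ∯ y in T(c ∘ Fin.succ, R ∘ Fin.succ),
          (∏ i, ((Fin.cons x y : Fin (k + 1) → ℂ) i - t i)⁻¹) * f (Fin.cons x y))
        (fun x => (x - t 0)⁻¹ * if ∀ i, t' i ∈ ball (c i.succ) (R i.succ) then
          (2 * Real.pi * I) ^ k * f (Fin.cons x t') else 0) (sphere (c 0) (R 0)) :=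
      fun x hx => hinner x (sphere_subset_closedBall hx)
    rw [circleIntegral.integral_congr (hR 0).le hsphere]
    -- With the last variables integrated out, one circle remains. It is evaluated by Cauchy's
    -- formula or Cauchy's theorem according to whether `t 0` lies inside; if some later coordinate
    -- is outside, the integrand is already zero.
    by_cases h : ∀ i, t' i ∈ ball (c i.succ) (R i.succ)
    · have hg : ∀ x ∈ closedBall (c 0) (R 0),
          DifferentiableAt ℂ (fun x => (2 * Real.pi * I) ^ k * f (Fin.cons x t')) x := fun x hx =>
        ((hcons x hx t' fun i => ball_subset_closedBall (h i)).comp x (hd1 t' x)).const_mul _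
      simp only [if_pos h]
      by_cases h0 : t 0 ∈ ball (c 0) (R 0)
      · rw [if_pos (fun i => Fin.cases h0 h i)]
        have := DiffContOnCl.circleIntegral_sub_inv_smul (c := c 0) (R := R 0) (w := t 0)
          (f := fun x => (2 * Real.pi * I) ^ k * f (Fin.cons x t'))
          (DifferentiableOn.diffContOnCl_ball (U := closedBall (c 0) (R 0))
            (fun x hx => (hg x hx).differentiableWithinAt) subset_rfl) h0
        simp only [smul_eq_mul] at this
        rw [this]
        have hc : (Fin.cons (t 0) t' : Fin (k + 1) → ℂ) = t := Fin.cons_self_tail t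
        rw [hc]
        ring
      · rw [if_neg fun H => h0 (H 0)]
        have hne : ∀ x ∈ closedBall (c 0) (R 0), x - t 0 ≠ 0 := by
          intro x hx hx0
          rw [sub_eq_zero.1 hx0, ← ball_union_sphere] at hx
          exact hx.elim h0 (ht 0)
        refine DiffContOnCl.circleIntegral_eq_zero (hR 0).le
          (DifferentiableOn.diffContOnCl_ball (U := closedBall (c 0) (R 0))
            (fun x hx => DifferentiableAt.differentiableWithinAt ?_) subset_rfl)
        exact ((differentiableAt_fun_id.sub_const (t 0)).inv (hne x hx)).mul (hg x hx)
    · rw [if_neg fun H => h fun i => H i.succ]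
      simp only [if_neg h, mul_zero]
      simp [circleIntegral]

/-- Integration over a torus against a continuous density, as a continuous linear functional. -/
theorem exists_torusIntegral_functional {k : ℕ} (c : Fin k → ℂ) (R : Fin k → ℝ)
    (f : (Fin k → ℂ) → ℂ) (hf : Continuous fun θ => f (torusMap c R θ)) :
    ∃ L : C(Icc (0 : Fin k → ℝ) (fun _ => 2 * Real.pi), ℂ) →L[ℂ] ℂ,
      ∀ (h : C(Icc (0 : Fin k → ℝ) (fun _ => 2 * Real.pi), ℂ)) (H : (Fin k → ℂ) → ℂ),
        (∀ θ, h θ = H (torusMap c R θ)) → L h = ∯ z in T(c, R), H z * f z := by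
  set K : Set (Fin k → ℝ) := Icc 0 fun _ => 2 * Real.pi with hK
  have hKm : MeasurableSet K := measurableSet_Icc
  set μ : Measure K := Measure.comap Subtype.val volume with hμ
  have : IsFiniteMeasure μ := by
    refine ⟨?_⟩
    rw [hμ, comap_subtype_coe_apply hKm]
    simpa using (isCompact_Icc (a := (0 : Fin k → ℝ)) (b := fun _ => 2 * Real.pi)).measure_lt_top
  -- The weight combines `f` with the Jacobian of the torus parametrization; its sup norm times the
  -- mass of `K` bounds the functional.
  set w : C(K, ℂ) := ⟨fun θ => (∏ i, (R i * exp (θ.1 i * I) * I : ℂ)) * f (torusMap c R θ), by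
    refine Continuous.mul ?_ (hf.comp continuous_subtype_val)
    refine continuous_finsetProd _ fun i _ => ?_
    have : Continuous fun θ : K => (θ.1 i : ℝ) := (continuous_apply i).comp continuous_subtype_val
    exact (continuous_const.mul (Complex.continuous_exp.comp
      ((Complex.continuous_ofReal.comp this).mul continuous_const))).mul continuous_const⟩ with hw
  have hint : ∀ h : C(K, ℂ), Integrable h μ := fun h =>
    (BoundedContinuousFunction.mkOfCompact h).integrable μ
  refine ⟨LinearMap.mkContinuous
    { toFun := fun h => ∫ θ, (h * w) θ ∂μ
      map_add' := fun a b => by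
        rw [add_mul, ← integral_add (hint _) (hint _)]; rfl
      map_smul' := fun a b => by
        rw [smul_mul_assoc, RingHom.id_apply, smul_eq_mul, ← integral_const_mul]; rfl }
    (‖w‖ * μ.real univ) (fun h => ?_), fun h H hH => ?_⟩
  · refine (norm_integral_le_of_norm_le_const (C := ‖h‖ * ‖w‖) (ae_of_all _ fun θ =>
      ((h * w).norm_coe_le_norm θ).trans (norm_mul_le _ _))).trans_eq ?_
    ring
  · change ∫ θ, (h * w) θ ∂μ = _
    rw [torusIntegral, ← integral_subtype_comap hKm]
    refine integral_congr_ae (ae_of_all _ fun θ => ?_)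
    simp only [ContinuousMap.mul_apply, hH, hw, ContinuousMap.coe_mk, smul_eq_mul]
    ring

end Torus

/-! ### Holomorphic symmetric functions are holomorphic in the elementary symmetric functions -/

section SymmetricAnalytic

open MvPolynomial

variable {k : ℕ}

/-- This is the fundamental theorem on symmetric polynomials, over a general algebra `R` because the
coefficients will be functions on the integration domain. -/
theorem exists_aeval_eq_aeval_esymmMap {R : Type*} [CommRing R] [Algebra ℂ R]
    {q : MvPolynomial (Fin k) R} (hq : q.IsSymmetric) :
    ∃ r : MvPolynomial (Fin k) R, ∀ t : Fin k → ℂ,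
      aeval (fun i => algebraMap ℂ R (t i)) q =
        aeval (fun i => algebraMap ℂ R (esymmMap k t i)) r := by
  obtain ⟨r, hr⟩ := (esymmAlgHom_fin_bijective R k).2 ⟨q, hq⟩
  refine ⟨r, fun t => ?_⟩
  have h1 : q = aeval (fun i : Fin k => esymm (Fin k) R (i + 1)) r := by
    rw [← esymmAlgHom_apply, hr]
  have h2 := comp_aeval_apply (R := R) (fun i : Fin k => esymm (Fin k) R (i + 1))
    (aeval (fun i => algebraMap ℂ R (t i)) : MvPolynomial (Fin k) R →ₐ[R] R) r
  rw [h1, h2]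
  congr 2
  funext i
  simp [esymmMap, esymm, map_sum, map_prod]

/-- The common denominator of the symmetrized Cauchy kernel. -/
def cauchyDenom {R : Type*} [CommRing R] (τ : Fin k → R) : MvPolynomial (Fin k) R :=
  ∏ j, ∏ l, (C (τ j) - X l)

/-- The numerator of the symmetrized Cauchy kernel. -/
def cauchyNum {R : Type*} [CommRing R] (τ : Fin k → R) : MvPolynomial (Fin k) R :=
  ∑ σ : Equiv.Perm (Fin k), ∏ j, ∏ l ∈ Finset.univ.erase (σ j), (C (τ j) - X l)

theorem cauchyDenom_isSymmetric {R : Type*} [CommRing R] (τ : Fin k → R) :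
    (cauchyDenom τ).IsSymmetric := by
  intro e
  simp only [cauchyDenom, map_prod, map_sub, rename_C, rename_X]
  exact Finset.prod_congr rfl fun j _ => Equiv.prod_comp e fun l => C (τ j) - X l

/-- Permuting the variables by `e` reindexes the sum by `σ ↦ e * σ`. -/
theorem cauchyNum_isSymmetric {R : Type*} [CommRing R] (τ : Fin k → R) :
    (cauchyNum τ).IsSymmetric := by
  intro e
  simp only [cauchyNum, map_sum, map_prod, map_sub, rename_C, rename_X]
  rw [← Equiv.sum_comp (Equiv.mulLeft e)
    fun σ => ∏ j, ∏ l ∈ Finset.univ.erase (σ j), (C (τ j) - X l)]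
  refine Finset.sum_congr rfl fun σ _ => Finset.prod_congr rfl fun j _ => ?_
  refine Finset.prod_bij (fun l _ => e l) ?_ ?_ ?_ ?_
  · intro l hl
    simpa using hl
  · intro a _ b _ h
    exact e.injective h
  · intro b hb
    refine ⟨e.symm b, ?_, by simp⟩
    simp only [Finset.mem_erase, Finset.mem_univ, and_true] at hb ⊢
    intro h
    exact hb (by simp [← h])
  · intro l _
    rfl

/-- Discs of this radius around distinct values are disjoint, while repeated values impose no
condition. This serves both the Cauchy integral at a possibly degenerate tuple and the separation of
branch points. -/
theorem exists_radius {t₀ : Fin k → ℂ} {r₀ : ℝ} (hr₀ : 0 < r₀) :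
    ∃ r, 0 < r ∧ r < r₀ ∧ ∀ i j, t₀ i ≠ t₀ j → 2 * r < dist (t₀ i) (t₀ j) := by
  have h : ∀ᶠ r : ℝ in 𝓝[>] 0, 0 < r ∧ r < r₀ ∧
      ∀ i j, t₀ i ≠ t₀ j → 2 * r < dist (t₀ i) (t₀ j) := by
    refine eventually_mem_nhdsWithin.and (Eventually.and ?_ ?_)
    · exact eventually_nhdsWithin_of_eventually_nhds (eventually_lt_nhds hr₀)
    · refine eventually_all.2 fun i => eventually_all.2 fun j => ?_
      by_cases hij : t₀ i = t₀ j
      · exact Eventually.of_forall fun r h => absurd hij h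
      · have : ∀ᶠ r : ℝ in 𝓝 0, 2 * r < dist (t₀ i) (t₀ j) := by
          have hc : Tendsto (fun r : ℝ => 2 * r) (𝓝 0) (𝓝 (2 * 0)) := by
            exact (continuous_const.mul continuous_id).tendsto _
          rw [mul_zero] at hc
          exact hc.eventually_lt_const (dist_pos.2 hij)
        exact eventually_nhdsWithin_of_eventually_nhds (this.mono fun r h _ => h)
  exact h.exists

open Metric in
/-- A function `g` of `c = (e₁(t), …, e_k(t))` is holomorphic if it is holomorphic as a function
of `t`. -/
theorem analyticAt_of_comp_esymmMap {g : (Fin k → ℂ) → ℂ} {t₀ : Fin k → ℂ}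
    (hg : AnalyticAt ℂ (g ∘ esymmMap k) t₀) : AnalyticAt ℂ g (esymmMap k t₀) := by
  classical
  obtain ⟨r₀, hr₀, hball⟩ := Metric.eventually_nhds_iff_ball.1 hg.eventually_analyticAt
  obtain ⟨r, hr, hrr₀, hsep⟩ := exists_radius (t₀ := t₀) hr₀
  have hG : ∀ z, (∀ i, z i ∈ closedBall (t₀ i) r) → AnalyticAt ℂ (g ∘ esymmMap k) z := by
    intro z hz
    refine hball z (mem_ball.2 (((dist_pi_le_iff hr.le).2 hz).trans_lt hrr₀))
  set K : Set (Fin k → ℝ) := Icc 0 fun _ => 2 * Real.pi with hK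
  set R : Fin k → ℝ := fun _ => r with hR
  have hRpos : ∀ i, 0 < R i := fun _ => hr
  have hcont : Continuous fun θ => (g ∘ esymmMap k) (torusMap t₀ R θ) := by
    refine continuous_iff_continuousAt.2 fun θ => ?_
    exact ContinuousAt.comp (f := torusMap t₀ R) (hG _ fun i => sphere_subset_closedBall
      (torusMap_mem_sphere hRpos θ i)).continuousAt (continuous_torusMap t₀ R).continuousAt
  obtain ⟨L, hL⟩ := exists_torusIntegral_functional t₀ R (g ∘ esymmMap k) hcont
  -- The torus coordinates become elements of the Banach algebra `C(K, ℂ)`, so that the kernel is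
  -- one algebra-valued function of `t` and no differentiation under the integral is needed.
  set τ : Fin k → C(K, ℂ) := fun j => ⟨fun θ => torusMap t₀ R θ j,
    (continuous_apply j).comp ((continuous_torusMap t₀ R).comp continuous_subtype_val)⟩ with hτ
  obtain ⟨d, hd⟩ := exists_aeval_eq_aeval_esymmMap (cauchyDenom_isSymmetric τ)
  obtain ⟨N, hN⟩ := exists_aeval_eq_aeval_esymmMap (cauchyNum_isSymmetric τ)
  have hdθ : ∀ (t : Fin k → ℂ) (θ : K),
      (aeval (fun i => algebraMap ℂ C(K, ℂ) (t i)) (cauchyDenom τ)) θ =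
        ∏ j, ∏ l, (torusMap t₀ R θ j - t l) := by
    intro t θ
    simp only [cauchyDenom, map_prod, map_sub, aeval_C, aeval_X, ContinuousMap.prod_apply,
      ContinuousMap.sub_apply]
    rfl
  have hNθ : ∀ (t : Fin k → ℂ) (θ : K),
      (aeval (fun i => algebraMap ℂ C(K, ℂ) (t i)) (cauchyNum τ)) θ =
        ∑ σ : Equiv.Perm (Fin k), ∏ j, ∏ l ∈ Finset.univ.erase (σ j),
          (torusMap t₀ R θ j - t l) := by
    intro t θ
    simp only [cauchyNum, map_sum, map_prod, map_sub, aeval_C, aeval_X, ContinuousMap.prod_apply,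
      ContinuousMap.sub_apply, ContinuousMap.sum_apply]
    rfl
  -- points of the open polydisc avoid the circles
  have hne : ∀ t : Fin k → ℂ, (∀ i, t i ∈ ball (t₀ i) r) → ∀ i j, t i ∉ sphere (t₀ j) (R j) := by
    intro t ht i j hs
    have h1 := mem_ball.1 (ht i)
    have h2 : dist (t i) (t₀ j) = r := hs
    by_cases hij : t₀ i = t₀ j
    · rw [hij] at h1; linarith
    · have := hsep i j hij
      have := dist_triangle_left (t₀ i) (t₀ j) (t i)
      linarith
  have hneθ : ∀ t : Fin k → ℂ, (∀ i, t i ∈ ball (t₀ i) r) → ∀ (θ : Fin k → ℝ) (i j : Fin k),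
      torusMap t₀ R θ j - t i ≠ 0 := by
    intro t ht θ i j h0
    have := torusMap_mem_sphere (c := t₀) hRpos θ j
    rw [sub_eq_zero.1 h0] at this
    exact hne t ht i j this
  have hunit : ∀ t : Fin k → ℂ, (∀ i, t i ∈ ball (t₀ i) r) →
      IsUnit (aeval (fun i => algebraMap ℂ C(K, ℂ) (t i)) (cauchyDenom τ)) := by
    intro t ht
    rw [ContinuousMap.isUnit_iff_forall_ne_zero]
    intro θ
    rw [hdθ]
    exact Finset.prod_ne_zero_iff.2 fun j _ => Finset.prod_ne_zero_iff.2 fun l _ =>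
      hneθ t ht θ l j
  -- The candidate for a multiple of `g`: numerator and denominator are polynomials in `c`, and
  -- inversion is analytic at units of the algebra.
  set Φ : (Fin k → ℂ) → ℂ := fun c =>
    L (Ring.inverse (aeval (fun i => algebraMap ℂ C(K, ℂ) (c i)) d) *
      aeval (fun i => algebraMap ℂ C(K, ℂ) (c i)) N) with hΦ
  have hpoly : ∀ (q : MvPolynomial (Fin k) C(K, ℂ)) (c : Fin k → ℂ), AnalyticAt ℂ
      (fun c : Fin k → ℂ => aeval (fun i => algebraMap ℂ C(K, ℂ) (c i)) q) c := by
    intro q c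
    refine AnalyticAt.aeval_mvPolynomial (f := fun (c : Fin k → ℂ) i => algebraMap ℂ C(K, ℂ) (c i))
      (fun i => ?_) q
    exact ((algebraMapCLM ℂ C(K, ℂ)).comp
      (ContinuousLinearMap.proj (R := ℂ) (φ := fun _ : Fin k => ℂ) i)).analyticAt c
  have ht₀ : ∀ i, t₀ i ∈ ball (t₀ i) r := fun i => mem_ball_self hr
  have hΦan : AnalyticAt ℂ Φ (esymmMap k t₀) := by
    refine (L.analyticAt _).comp (AnalyticAt.mul ?_ (hpoly N _))
    refine AnalyticAt.comp (g := Ring.inverse) ?_ (hpoly d _)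
    rw [← hd]
    exact analyticAt_inverse (hunit t₀ ht₀).unit
  -- Each permutation in the stabilizer of `t₀` contributes one copy of `g` to the averaged
  -- integral; the identity shows that `M` is nonzero.
  set M : ℂ := ((Finset.univ.filter fun σ : Equiv.Perm (Fin k) => t₀ ∘ σ = t₀).card : ℂ) with hM
  have hM0 : M ≠ 0 := by
    rw [hM, Nat.cast_ne_zero, Finset.card_ne_zero]
    exact ⟨1, by simp⟩
  have hpi : (2 * Real.pi * Complex.I : ℂ) ^ k ≠ 0 :=
    pow_ne_zero _ (by simp [Real.pi_ne_zero])
  have hmain : ∀ t : Fin k → ℂ, (∀ i, t i ∈ ball (t₀ i) r) →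
      Φ (esymmMap k t) = M * ((2 * Real.pi * Complex.I) ^ k * g (esymmMap k t)) := by
    intro t ht
    set h : Equiv.Perm (Fin k) → C(K, ℂ) := fun σ =>
      ⟨fun θ => ∏ j, (torusMap t₀ R θ j - t (σ j))⁻¹, by
        refine continuous_finsetProd _ fun j _ => Continuous.inv₀ ?_ fun θ => hneθ t ht θ _ _
        exact ((continuous_apply j).comp ((continuous_torusMap t₀ R).comp
          continuous_subtype_val)).sub continuous_const⟩ with hh
    -- The quotient is the sum over `σ` of the Cauchy kernels at `t ∘ σ`, put over a common
    -- denominator.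
    have hsum : Ring.inverse (aeval (fun i => algebraMap ℂ C(K, ℂ) (esymmMap k t i)) d) *
        aeval (fun i => algebraMap ℂ C(K, ℂ) (esymmMap k t i)) N = ∑ σ, h σ := by
      rw [← hd, ← hN, Ring.inverse_mul_eq_iff_eq_mul _ _ _ (hunit t ht)]
      ext θ
      rw [hNθ, ContinuousMap.mul_apply, hdθ, ContinuousMap.sum_apply, Finset.mul_sum]
      refine Finset.sum_congr rfl fun σ _ => ?_
      rw [hh, ContinuousMap.coe_mk, ← Finset.prod_mul_distrib]
      refine Finset.prod_congr rfl fun j _ => ?_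
      rw [← Finset.mul_prod_erase _ _ (Finset.mem_univ (σ j))]
      field_simp [hneθ t ht θ (σ j) j]
    have hσ : ∀ σ, L (h σ) = if t₀ ∘ σ = t₀ then
        (2 * Real.pi * Complex.I) ^ k * g (esymmMap k t) else 0 := by
      intro σ
      rw [hL (h σ) (fun z => ∏ j, (z j - (t ∘ σ) j)⁻¹) fun θ => rfl,
        torusIntegral_cauchy t₀ R hRpos _ (fun z hz => (hG z hz).differentiableAt) (t ∘ σ)
          (fun i => hne t ht _ _)]
      -- If `σ` moves some value of `t₀`, the permuted point leaves the polydisc, because discs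
      -- around distinct values are disjoint; then Cauchy's integral vanishes.
      have hiff : (∀ i, (t ∘ σ) i ∈ ball (t₀ i) (R i)) ↔ t₀ ∘ σ = t₀ := by
        constructor
        · intro H
          funext i
          by_contra hi
          have h1 := hsep _ _ hi
          have h2 := mem_ball.1 (H i)
          have h3 := mem_ball.1 (ht (σ i))
          have h4 := dist_triangle_left (t₀ (σ i)) (t₀ i) (t (σ i))
          simp only [Function.comp_apply, hR] at h1 h2
          linarith
        · intro H i
          rw [← H]
          exact ht (σ i)
      rw [Function.comp_apply (f := g), esymmMap_comp_perm]
      exact if_congr hiff rfl rfl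
    rw [hΦ]
    simp only
    rw [hsum, map_sum, Finset.sum_congr rfl fun σ _ => hσ σ, ← Finset.sum_filter,
      Finset.sum_const, nsmul_eq_mul]
  have hev : g =ᶠ[𝓝 (esymmMap k t₀)]
      fun c => (M * (2 * Real.pi * Complex.I) ^ k)⁻¹ * Φ c := by
    -- Openness of `esymmMap` turns the identity on the polydisc into one on a neighbourhood in the
    -- variable `c`.
    have hnhds : esymmMap k '' {t | ∀ i, t i ∈ ball (t₀ i) r} ∈ 𝓝 (esymmMap k t₀) := by
      refine isOpenQuotientMap_esymmMap.isOpenMap.image_mem_nhds ?_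
      refine IsOpen.mem_nhds ?_ ht₀
      simp only [ofPred_forall]
      exact isOpen_iInter_of_finite fun i => isOpen_ball.preimage (continuous_apply i)
    filter_upwards [hnhds]
    rintro _ ⟨t, ht, rfl⟩
    rw [hmain t ht]
    field_simp
  exact (analyticAt_const.mul hΦan).congr hev.symm

end SymmetricAnalytic

/-! ### Powers of a Riemann surface -/

section Pi

variable {X : Type*} [TopologicalSpace X] [ChartedSpace ℂ X] {k : ℕ}

theorem contMDiffAt_pi_apply (v : Fin k → X) (j : Fin k) :
    ContMDiffAt (ModelWithCorners.pi fun _ : Fin k => 𝓘(ℂ, ℂ)) 𝓘(ℂ, ℂ) ω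
      (fun v : Fin k → X => v j) v := by
  rw [contMDiffAt_iff]
  refine ⟨(continuous_apply j).continuousAt, ?_⟩
  have h : ContDiffWithinAt ℂ ω (fun u : Fin k → ℂ => u j)
      (range (ModelWithCorners.pi fun _ : Fin k => 𝓘(ℂ, ℂ)))
      (extChartAt (ModelWithCorners.pi fun _ : Fin k => 𝓘(ℂ, ℂ)) v v) :=
    (contDiff_apply ℂ ℂ j).contDiffWithinAt
  refine h.congr_of_eventuallyEq ?_ ?_
  · have hmem := extChartAt_target_mem_nhdsWithin
      (I := ModelWithCorners.pi fun _ : Fin k => 𝓘(ℂ, ℂ)) v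
    filter_upwards [hmem] with u hu
    exact (chartAt ℂ (v j)).right_inv (hu.2 j (mem_univ j))
  · exact congrArg (chartAt ℂ (v j)) ((chartAt ℂ (v j)).left_inv (mem_chart_source ℂ (v j)))

/-- Charts of the power are products of charts of `X`, so holomorphy is tested entry by entry. -/
theorem contMDiffAt_pi_iff {E H N : Type*} [NormedAddCommGroup E] [NormedSpace ℂ E]
    [TopologicalSpace H] [TopologicalSpace N] [ChartedSpace H N] {J : ModelWithCorners ℂ E H}
    {f : N → Fin k → X} {x : N} :
    ContMDiffAt J (ModelWithCorners.pi fun _ : Fin k => 𝓘(ℂ, ℂ)) ω f x ↔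
      ∀ j, ContMDiffAt J 𝓘(ℂ, ℂ) ω (fun x => f x j) x := by
  refine ⟨fun h j => (contMDiffAt_pi_apply (f x) j).comp x h, fun h => ?_⟩
  simp only [contMDiffAt_iff] at h ⊢
  exact ⟨continuousAt_pi.2 fun j => (h j).1, contDiffWithinAt_pi.2 fun j => (h j).2⟩

end Pi

/-! ### Charts containing finitely many given points -/

section Chart

variable {X : Type*} [TopologicalSpace X] [ChartedSpace ℂ X] [IsManifold 𝓘(ℂ, ℂ) ω X]

/-- Membership is a local condition on the map and its inverse, and near each point these agree with
those of `e` or of `e'`. -/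
theorem disjointUnion_mem_maximalAtlas {e e' : OpenPartialHomeomorph X ℂ}
    (he : e ∈ IsManifold.maximalAtlas 𝓘(ℂ, ℂ) ω X) (he' : e' ∈ IsManifold.maximalAtlas 𝓘(ℂ, ℂ) ω X)
    [∀ x, Decidable (x ∈ e.source)] [∀ y, Decidable (y ∈ e.target)]
    (hs : Disjoint e.source e'.source) (ht : Disjoint e.target e'.target) :
    e.disjointUnion e' hs ht ∈ IsManifold.maximalAtlas 𝓘(ℂ, ℂ) ω X := by
  have h1 : ∀ x ∈ e.source, e.disjointUnion e' hs ht x = e x := fun x hx =>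
    piecewise_eq_of_mem e.source e e' hx
  have h2 : ∀ x ∈ e'.source, e.disjointUnion e' hs ht x = e' x := fun x hx =>
    piecewise_eq_of_notMem e.source e e' (disjoint_right.1 hs hx)
  have h3 : ∀ y ∈ e.target, (e.disjointUnion e' hs ht).symm y = e.symm y := fun x hx =>
    piecewise_eq_of_mem e.target e.symm e'.symm hx
  have h4 : ∀ y ∈ e'.target, (e.disjointUnion e' hs ht).symm y = e'.symm y := fun x hx =>
    piecewise_eq_of_notMem e.target e.symm e'.symm (disjoint_right.1 ht hx)
  refine OpenPartialHomeomorph.mem_maximalAtlas_of_contMDiffOn _ ?_ ?_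
  · rintro x (hx | hx)
    · refine ((contMDiffAt_of_mem_maximalAtlas he hx).congr_of_eventuallyEq ?_).contMDiffWithinAt
      filter_upwards [e.open_source.mem_nhds hx] with y hy using h1 y hy
    · refine ((contMDiffAt_of_mem_maximalAtlas he' hx).congr_of_eventuallyEq ?_).contMDiffWithinAt
      filter_upwards [e'.open_source.mem_nhds hx] with y hy using h2 y hy
  · rintro x (hx | hx)
    · refine ((contMDiffAt_symm_of_mem_maximalAtlas he hx).congr_of_eventuallyEq
        ?_).contMDiffWithinAt
      filter_upwards [e.open_target.mem_nhds hx] with y hy using h3 y hy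
    · refine ((contMDiffAt_symm_of_mem_maximalAtlas he' hx).congr_of_eventuallyEq
        ?_).contMDiffWithinAt
      filter_upwards [e'.open_target.mem_nhds hx] with y hy using h4 y hy

theorem transHomeomorph_addRight_mem_maximalAtlas {e : OpenPartialHomeomorph X ℂ}
    (he : e ∈ IsManifold.maximalAtlas 𝓘(ℂ, ℂ) ω X) (a : ℂ) :
    e.transHomeomorph (Homeomorph.addRight a) ∈ IsManifold.maximalAtlas 𝓘(ℂ, ℂ) ω X := by
  have ha : ∀ b : ℂ, ContMDiff 𝓘(ℂ, ℂ) 𝓘(ℂ, ℂ) ω fun z : ℂ => z + b := fun b =>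
    (contDiff_id.add contDiff_const).contMDiff
  refine OpenPartialHomeomorph.mem_maximalAtlas_of_contMDiffOn _ ?_ ?_
  · exact (ha a).comp_contMDiffOn (contMDiffOn_of_mem_maximalAtlas he)
  · exact (contMDiffOn_symm_of_mem_maximalAtlas he).comp ((ha (-a)).contMDiffOn) fun y hy => hy

/-- Any finite set of points of a Riemann surface lies in the domain of a single chart. -/
theorem exists_chart_of_finite [T2Space X] [Nonempty X] {S : Set X} (hS : S.Finite) :
    ∃ e ∈ IsManifold.maximalAtlas 𝓘(ℂ, ℂ) ω X, S ⊆ e.source := by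
  classical
  induction S, hS using Set.Finite.induction_on with
  | empty =>
    exact ⟨chartAt ℂ (Classical.arbitrary X), IsManifold.chart_mem_maximalAtlas _,
      empty_subset _⟩
  | @insert w S hw hS ih =>
    obtain ⟨e, he, hSe⟩ := ih
    obtain ⟨A, B, hA, hB, hSA, hwB, hAB⟩ := SeparatedNhds.of_isCompact_isCompact
      hS.isCompact isCompact_singleton (disjoint_singleton_right.2 hw)
    -- The old points land in the disc of radius `M` about `0`. Translating the new chart so that
    -- `w` goes to `M + 1` puts the unit disc around its value outside that disc, so the restricted
    -- targets are disjoint.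
    obtain ⟨M, hM0, hM⟩ := (hS.image e).isBounded.subset_ball_lt 0 0
    set e₂ := (chartAt ℂ w).transHomeomorph (Homeomorph.addRight ((M : ℂ) + 1 - chartAt ℂ w w))
      with he₂
    have hmem₂ : e₂ ∈ IsManifold.maximalAtlas 𝓘(ℂ, ℂ) ω X :=
      transHomeomorph_addRight_mem_maximalAtlas (IsManifold.chart_mem_maximalAtlas w) _
    have hw₂ : w ∈ e₂.source := mem_chart_source ℂ w
    have hew₂ : e₂ w = M + 1 := by
      change chartAt ℂ w w + ((M : ℂ) + 1 - chartAt ℂ w w) = M + 1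
      ring
    have ho1 : IsOpen (A ∩ (e.source ∩ e ⁻¹' Metric.ball 0 M)) :=
      hA.inter (e.isOpen_inter_preimage Metric.isOpen_ball)
    have ho2 : IsOpen (B ∩ (e₂.source ∩ e₂ ⁻¹' Metric.ball (M + 1 : ℂ) 1)) :=
      hB.inter (e₂.isOpen_inter_preimage Metric.isOpen_ball)
    set f₁ := e.restr (A ∩ (e.source ∩ e ⁻¹' Metric.ball 0 M)) with hf₁
    set f₂ := e₂.restr (B ∩ (e₂.source ∩ e₂ ⁻¹' Metric.ball (M + 1 : ℂ) 1)) with hf₂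
    have hs₁ : f₁.source = e.source ∩ (A ∩ (e.source ∩ e ⁻¹' Metric.ball 0 M)) := by
      rw [hf₁, OpenPartialHomeomorph.restr_source, ho1.interior_eq]
    have hs₂ : f₂.source = e₂.source ∩ (B ∩ (e₂.source ∩ e₂ ⁻¹' Metric.ball (M + 1 : ℂ) 1)) := by
      rw [hf₂, OpenPartialHomeomorph.restr_source, ho2.interior_eq]
    have hds : Disjoint f₁.source f₂.source := by
      rw [hs₁, hs₂]
      exact hAB.mono (fun x hx => hx.2.1) fun x hx => hx.2.1
    have hdt : Disjoint f₁.target f₂.target := by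
      rw [disjoint_left]
      intro y h1 h2
      have h3 := f₁.map_target h1
      have h4 := f₂.map_target h2
      rw [hs₁] at h3
      rw [hs₂] at h4
      have h5 : f₁ (f₁.symm y) ∈ Metric.ball (0 : ℂ) M := h3.2.2.2
      have h6 : f₂ (f₂.symm y) ∈ Metric.ball (M + 1 : ℂ) 1 := h4.2.2.2
      rw [f₁.right_inv h1] at h5
      rw [f₂.right_inv h2] at h6
      rw [Metric.mem_ball, dist_zero_right] at h5
      rw [Metric.mem_ball, dist_comm, dist_eq_norm] at h6
      have h7 : ‖(M + 1 : ℂ)‖ = M + 1 := by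
        rw [← Complex.ofReal_one, ← Complex.ofReal_add, Complex.norm_real, Real.norm_eq_abs,
          abs_of_pos (by linarith)]
      have h8 := norm_sub_norm_le (M + 1 : ℂ) y
      rw [h7] at h8
      linarith
    refine ⟨f₁.disjointUnion f₂ hds hdt, disjointUnion_mem_maximalAtlas
      (restr_mem_maximalAtlas _ he ho1) (restr_mem_maximalAtlas _ hmem₂ ho2) hds hdt, ?_⟩
    rintro x (rfl | hx)
    · right
      rw [hs₂]
      refine ⟨hw₂, hwB rfl, hw₂, ?_⟩
      rw [mem_preimage, hew₂]
      exact Metric.mem_ball_self one_pos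
    · left
      rw [hs₁]
      exact ⟨hSe hx, hSA hx, hSe hx, hM (mem_image_of_mem e hx)⟩

end Chart

/-! ### The complex structure of the symmetric product -/

section SymChart

variable {X Y : Type*} [TopologicalSpace X] [TopologicalSpace Y] {k : ℕ}

theorem isOpen_forall_mem_sym {U : Set X} (hU : IsOpen U) :
    IsOpen {z : Sym X k | ∀ x ∈ z, x ∈ U} := by
  rw [isOpen_sym_iff]
  have : symMk ⁻¹' {z : Sym X k | ∀ x ∈ z, x ∈ U} = univ.pi fun _ => U := by
    ext v
    simp [forall_mem_symMk (q := fun x => x ∈ U)]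
  rw [this]
  exact isOpen_set_pi finite_univ fun _ _ => hU

theorem continuousOn_symMap {U : Set X} (hU : IsOpen U) {f : X → Y} (hf : ContinuousOn f U) :
    ContinuousOn (Sym.map f) {z : Sym X k | ∀ x ∈ z, x ∈ U} := by
  rw [continuousOn_sym_iff (isOpen_forall_mem_sym hU)]
  have : Sym.map f ∘ symMk = symMk ∘ fun v : Fin k → X => f ∘ v := funext fun v => map_symMk f v
  rw [this]
  refine continuous_symMk.comp_continuousOn (continuousOn_pi.2 fun i => ?_)
  exact hf.comp (continuous_apply i).continuousOn fun v hv =>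
    forall_mem_symMk (q := fun x => x ∈ U).1 hv i

/-- A partial homeomorphism induces a partial homeomorphism of symmetric products. -/
def OpenPartialHomeomorph.symMap (e : OpenPartialHomeomorph X Y) (k : ℕ) :
    OpenPartialHomeomorph (Sym X k) (Sym Y k) where
  toFun := Sym.map e
  invFun := Sym.map e.symm
  source := {z | ∀ x ∈ z, x ∈ e.source}
  target := {z | ∀ y ∈ z, y ∈ e.target}
  map_source' z hz y hy := by
    obtain ⟨x, hx, rfl⟩ := Sym.mem_map.1 hy
    exact e.map_source (hz x hx)
  map_target' z hz y hy := by
    obtain ⟨x, hx, rfl⟩ := Sym.mem_map.1 hy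
    exact e.map_target (hz x hx)
  left_inv' z hz := by
    rw [Sym.map_map]
    exact (Sym.map_congr fun x hx => e.left_inv (hz x hx)).trans (Sym.map_id' z)
  right_inv' z hz := by
    rw [Sym.map_map]
    exact (Sym.map_congr fun x hx => e.right_inv (hz x hx)).trans (Sym.map_id' z)
  open_source := isOpen_forall_mem_sym e.open_source
  open_target := isOpen_forall_mem_sym e.open_target
  continuousOn_toFun := continuousOn_symMap e.open_source e.continuousOn
  continuousOn_invFun := continuousOn_symMap e.open_target e.continuousOn_symm

/-- The chart of `Sym^k(X)` given by the elementary symmetric functions of a coordinate of `X`. -/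
def symChart (e : OpenPartialHomeomorph X ℂ) (k : ℕ) :
    OpenPartialHomeomorph (Sym X k) (Fin k → ℂ) :=
  (e.symMap k).transHomeomorph (symEsymmHomeomorph k)

theorem symMk_mem_symChart_source {e : OpenPartialHomeomorph X ℂ} {v : Fin k → X} :
    symMk v ∈ (symChart e k).source ↔ ∀ i, v i ∈ e.source :=
  forall_mem_symMk (q := fun x => x ∈ e.source)

theorem symChart_symMk (e : OpenPartialHomeomorph X ℂ) (v : Fin k → X) :
    symChart e k (symMk v) = esymmMap k (e ∘ v) := by
  change symEsymmHomeomorph k (Sym.map e (symMk v)) = _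
  rw [map_symMk, symEsymmHomeomorph_symMk]

theorem symChart_symm_esymmMap (e : OpenPartialHomeomorph X ℂ) (t : Fin k → ℂ) :
    (symChart e k).symm (esymmMap k t) = symMk (e.symm ∘ t) := by
  change Sym.map e.symm ((symEsymmHomeomorph k).symm (esymmMap k t)) = _
  rw [← symEsymmHomeomorph_symMk, Homeomorph.symm_apply_apply, map_symMk]

theorem esymmMap_mem_symChart_target {e : OpenPartialHomeomorph X ℂ} {t : Fin k → ℂ} :
    esymmMap k t ∈ (symChart e k).target ↔ ∀ i, t i ∈ e.target := by
  change (symEsymmHomeomorph k).symm (esymmMap k t) ∈ (e.symMap k).target ↔ _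
  rw [← symEsymmHomeomorph_symMk, Homeomorph.symm_apply_apply]
  exact forall_mem_symMk (q := fun x => x ∈ e.target)

theorem contMDiffAt_symChart_comp_symMk [ChartedSpace ℂ X]
    {e : OpenPartialHomeomorph X ℂ}
    (he : e ∈ IsManifold.maximalAtlas 𝓘(ℂ, ℂ) ω X) {v : Fin k → X} (hv : ∀ i, v i ∈ e.source) :
    ContMDiffAt (ModelWithCorners.pi fun _ : Fin k => 𝓘(ℂ, ℂ)) 𝓘(ℂ, Fin k → ℂ) ω
      (symChart e k ∘ symMk) v := by
  have : symChart e k ∘ symMk = esymmMap k ∘ fun v : Fin k → X => e ∘ v :=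
    funext fun v => symChart_symMk e v
  rw [this]
  refine ContMDiffAt.comp (I' := 𝓘(ℂ, Fin k → ℂ)) v
    (analyticAt_esymmMap _).contDiffAt.contMDiffAt (contMDiffAt_pi_space.2 fun i => ?_)
  exact (contMDiffAt_of_mem_maximalAtlas he (hv i)).comp v (contMDiffAt_pi_apply v i)

/-- Pulled back to the roots, the transition applies `e' ∘ e.symm` to each entry and then takes
elementary symmetric functions. This is holomorphic, and `analyticAt_of_comp_esymmMap` descends it.
-/
theorem analyticAt_symChart_transition [ChartedSpace ℂ X]
    {e e' : OpenPartialHomeomorph X ℂ}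
    (he : e ∈ IsManifold.maximalAtlas 𝓘(ℂ, ℂ) ω X) (he' : e' ∈ IsManifold.maximalAtlas 𝓘(ℂ, ℂ) ω X)
    {c : Fin k → ℂ} (hc : c ∈ ((symChart e k).symm.trans (symChart e' k)).source) :
    AnalyticAt ℂ (symChart e' k ∘ (symChart e k).symm) c := by
  obtain ⟨t, rfl⟩ := isOpenQuotientMap_esymmMap.surjective c
  have h1 : ∀ i, t i ∈ e.target := esymmMap_mem_symChart_target.1 hc.1
  have h2 : ∀ i, e.symm (t i) ∈ e'.source := by
    have : (symChart e k).symm (esymmMap k t) ∈ (symChart e' k).source := hc.2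
    rw [symChart_symm_esymmMap] at this
    exact symMk_mem_symChart_source.1 this
  rw [analyticAt_pi_iff]
  intro i
  refine analyticAt_of_comp_esymmMap ?_
  have h3 : (fun c => (symChart e' k ∘ (symChart e k).symm) c i) ∘ esymmMap k =
      (fun u => esymmMap k u i) ∘ fun t j => e' (e.symm (t j)) := by
    funext t
    simp only [Function.comp_apply, symChart_symm_esymmMap, symChart_symMk]
    rfl
  rw [h3]
  refine AnalyticAt.comp (g := fun u => esymmMap k u i)
    (analyticAt_pi_iff.1 (analyticAt_esymmMap _) i) (AnalyticAt.pi fun j => ?_)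
  have h4 : ContMDiffAt 𝓘(ℂ, ℂ) 𝓘(ℂ, ℂ) ω (e' ∘ e.symm) (t j) :=
    (contMDiffAt_of_mem_maximalAtlas he' (h2 j)).comp _
      (contMDiffAt_symm_of_mem_maximalAtlas he (h1 j))
  have h5 : AnalyticAt ℂ (e' ∘ e.symm) (t j) := h4.contDiffAt.analyticAt
  exact h5.comp (f := fun t : Fin k → ℂ => t j)
    ((ContinuousLinearMap.proj (R := ℂ) (φ := fun _ : Fin k => ℂ) j).analyticAt t)

end SymChart

/-! ### Existence of the complex structure on the symmetric product -/

section SymStructure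

variable {X : Type*} [TopologicalSpace X] [ChartedSpace ℂ X] [IsManifold 𝓘(ℂ, ℂ) ω X] {k : ℕ}

theorem exists_symChart [T2Space X] [Nonempty X] (z : Sym X k) :
    ∃ e : OpenPartialHomeomorph X ℂ, e ∈ IsManifold.maximalAtlas 𝓘(ℂ, ℂ) ω X ∧
      z ∈ (symChart e k).source := by
  obtain ⟨v, rfl⟩ := symMk_surjective z
  obtain ⟨e, he, h⟩ := exists_chart_of_finite (finite_range v)
  exact ⟨e, he, symMk_mem_symChart_source.2 fun i => h (mem_range_self i)⟩

variable (X k) in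
/-- The charted space structure of `Sym^k(X)` given by elementary symmetric functions. -/
@[reducible] def symChartedSpace [T2Space X] [Nonempty X] : ChartedSpace (Fin k → ℂ) (Sym X k) where
  atlas := {φ | ∃ e ∈ IsManifold.maximalAtlas 𝓘(ℂ, ℂ) ω X, φ = symChart e k}
  chartAt z := symChart (exists_symChart z).choose k
  mem_chart_source z := (exists_symChart z).choose_spec.2
  chart_mem_atlas z := ⟨_, (exists_symChart z).choose_spec.1, rfl⟩

variable (X k) in
theorem isManifold_symChartedSpace [T2Space X] [Nonempty X] :
    letI := symChartedSpace X k
    IsManifold 𝓘(ℂ, Fin k → ℂ) ω (Sym X k) := by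
  let _ := symChartedSpace X k
  refine isManifold_of_contDiffOn _ _ _ ?_
  rintro _ _ ⟨e, he, rfl⟩ ⟨e', he', rfl⟩
  simp only [modelWithCornersSelf_coe, modelWithCornersSelf_coe_symm, Set.preimage_id_eq,
    Set.range_id, Set.inter_univ, Function.id_comp, Function.comp_id, id]
  exact fun c hc => (analyticAt_symChart_transition he he' hc).contDiffAt.contDiffWithinAt

variable (X k) in
/-- The charts given by elementary symmetric functions make `Sym^k(X)` into a complex manifold
whose holomorphic functions are the functions with holomorphic pullback to `X^k`. -/
theorem isSymComplexStructure_symChartedSpace [T2Space X] [Nonempty X] :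
    IsSymComplexStructure (symChartedSpace X k) := by
  let _ := symChartedSpace X k
  have hM := isManifold_symChartedSpace X k
  refine ⟨hM, fun U hU g => ⟨fun h => ?_, fun h z hz => ?_⟩⟩
  · have hmk : ContMDiff (ModelWithCorners.pi fun _ : Fin k => 𝓘(ℂ, ℂ)) 𝓘(ℂ, Fin k → ℂ) ω
        (symMk : (Fin k → X) → Sym X k) := by
      intro v
      rw [contMDiffAt_iff_target]
      refine ⟨continuous_symMk.continuousAt, ?_⟩
      exact contMDiffAt_symChart_comp_symMk (exists_symChart (symMk v)).choose_spec.1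
        (symMk_mem_symChart_source.1 (exists_symChart (symMk v)).choose_spec.2)
    exact h.comp hmk.contMDiffOn fun v hv => hv
  · obtain ⟨v, rfl⟩ := symMk_surjective z
    have he := (exists_symChart (symMk v)).choose_spec.1
    have hsrc := symMk_mem_symChart_source.1 (exists_symChart (symMk v)).choose_spec.2
    set e := (exists_symChart (symMk v)).choose with hedef
    refine ContMDiffAt.contMDiffWithinAt ?_
    rw [contMDiffAt_iff_source]
    refine ContMDiffAt.contMDiffWithinAt (ContDiffAt.contMDiffAt (AnalyticAt.contDiffAt ?_))
    change AnalyticAt ℂ (g ∘ (symChart e k).symm) (symChart e k (symMk v))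
    rw [symChart_symMk]
    -- It suffices to check holomorphy in the roots `t`, where the function is the given pullback `g
    -- ∘ symMk` after `e.symm` in each entry.
    refine analyticAt_of_comp_esymmMap ?_
    have h1 : (g ∘ (symChart e k).symm) ∘ esymmMap k =
        (g ∘ symMk) ∘ fun t : Fin k → ℂ => e.symm ∘ t :=
      funext fun t => congrArg g (symChart_symm_esymmMap e t)
    rw [h1]
    have hinv : (e.symm ∘ (e ∘ v)) = v := funext fun i => e.left_inv (hsrc i)
    have h2 : ContMDiffAt 𝓘(ℂ, Fin k → ℂ) (ModelWithCorners.pi fun _ : Fin k => 𝓘(ℂ, ℂ)) ω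
        (fun t : Fin k → ℂ => e.symm ∘ t) (e ∘ v) := by
      refine contMDiffAt_pi_iff.2 fun i => ?_
      exact ContMDiffAt.comp (I' := 𝓘(ℂ, ℂ)) (e ∘ v)
        (contMDiffAt_symm_of_mem_maximalAtlas he (e.map_source (hsrc i)))
        (contDiff_apply ℂ ℂ i).contDiffAt.contMDiffAt
    have h3 : ContMDiffAt (ModelWithCorners.pi fun _ : Fin k => 𝓘(ℂ, ℂ)) 𝓘(ℂ, ℂ) ω (g ∘ symMk)
        (e.symm ∘ (e ∘ v)) := by
      rw [hinv]
      exact (h v hz).contMDiffAt ((hU.preimage continuous_symMk).mem_nhds hz)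
    exact (h3.comp _ h2).contDiffAt.analyticAt

end SymStructure

/-! ### Consequences of the defining properties, for an arbitrary admissible structure -/

namespace IsSymComplexStructure

variable {X : Type*} [TopologicalSpace X] [ChartedSpace ℂ X] {k : ℕ}
  {cs : ChartedSpace (Fin k → ℂ) (Sym X k)}

/-- The quotient map `X^k → Sym^k(X)` is holomorphic. -/
theorem contMDiff_symMk (H : IsSymComplexStructure cs) :
    ContMDiff (ModelWithCorners.pi fun _ : Fin k => 𝓘(ℂ, ℂ)) 𝓘(ℂ, Fin k → ℂ) ω
      (symMk : (Fin k → X) → Sym X k) := by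
  have := H.isManifold
  intro v
  rw [contMDiffAt_iff_target]
  refine ⟨continuous_symMk.continuousAt, contMDiffAt_pi_space.2 fun i => ?_⟩
  -- Chart coordinates are holomorphic functions on an open subset of the symmetric product, so the
  -- defining property makes their pullbacks holomorphic.
  have h1 : ContMDiffOn 𝓘(ℂ, Fin k → ℂ) 𝓘(ℂ, ℂ) ω
      (fun z => extChartAt 𝓘(ℂ, Fin k → ℂ) (symMk v) z i)
      (chartAt (Fin k → ℂ) (symMk v)).source :=
    contMDiffOn_pi_space.1 (contMDiffOn_extChartAt (x := symMk v)) i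
  have hopen := (chartAt (Fin k → ℂ) (symMk v)).open_source
  have h2 := (H.contMDiffOn_iff _ hopen _).1 h1
  exact h2.contMDiffAt ((hopen.preimage continuous_symMk).mem_nhds
    (mem_chart_source (Fin k → ℂ) (symMk v)))

open Classical in
/-- A coordinate of a chart of `X`, extended by zero. -/
def extendZero (e : OpenPartialHomeomorph X ℂ) (x : X) : ℂ := if x ∈ e.source then e x else 0

theorem contMDiffAt_extendZero {e : OpenPartialHomeomorph X ℂ} [IsManifold 𝓘(ℂ, ℂ) ω X]
    (he : e ∈ IsManifold.maximalAtlas 𝓘(ℂ, ℂ) ω X) {x : X} (hx : x ∈ e.source) :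
    ContMDiffAt 𝓘(ℂ, ℂ) 𝓘(ℂ, ℂ) ω (extendZero e) x := by
  refine (contMDiffAt_of_mem_maximalAtlas he hx).congr_of_eventuallyEq ?_
  filter_upwards [e.open_source.mem_nhds hx] with y hy using if_pos hy

theorem contMDiffAt_extendZero_of_disjoint {e : OpenPartialHomeomorph X ℂ} {U : Set X}
    (hU : IsOpen U) (hd : Disjoint e.source U) {x : X} (hx : x ∈ U) :
    ContMDiffAt 𝓘(ℂ, ℂ) 𝓘(ℂ, ℂ) ω (extendZero e) x := by
  refine (contMDiffAt_const (c := (0 : ℂ))).congr_of_eventuallyEq ?_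
  filter_upwards [hU.mem_nhds hx] with y hy using if_neg (disjoint_right.1 hd hy)

/-- The sum of the values of `extendZero (D i)` over the points of an element of `Sym^k(X)`. -/
def prodCoord (D : Fin k → OpenPartialHomeomorph X ℂ) (z : Sym X k) (i : Fin k) : ℂ :=
  ((z : Multiset X).map (extendZero (D i))).sum

omit [ChartedSpace ℂ X] in
theorem prodCoord_symMk_eq_sum (D : Fin k → OpenPartialHomeomorph X ℂ) (v : Fin k → X)
    (i : Fin k) : prodCoord D (symMk v) i = ∑ j, extendZero (D i) (v j) := by
  change ((Finset.univ.val.map v).map (extendZero (D i))).sum = _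
  rw [Multiset.map_map]
  rfl

omit [ChartedSpace ℂ X] in
-- Only the `i`-th entry lies in the domain of `D i`; every other entry contributes the default
-- value `0`.
theorem prodCoord_symMk {D : Fin k → OpenPartialHomeomorph X ℂ}
    (hD : Pairwise fun i j => Disjoint (D i).source (D j).source) {v : Fin k → X}
    (hv : ∀ i, v i ∈ (D i).source) (i : Fin k) : prodCoord D (symMk v) i = D i (v i) := by
  rw [prodCoord_symMk_eq_sum, Finset.sum_eq_single i]
  · exact if_pos (hv i)
  · intro j _ hj
    exact if_neg (disjoint_left.1 (hD hj) (hv j))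
  · simp

/-- The elements `[z₁, …, z_k]` with `zᵢ` in the domain of `Dᵢ`. -/
def prodSource (D : Fin k → OpenPartialHomeomorph X ℂ) : Set (Sym X k) :=
  symMk '' {v | ∀ i, v i ∈ (D i).source}

omit [ChartedSpace ℂ X] in
theorem isOpen_prodSource (D : Fin k → OpenPartialHomeomorph X ℂ) : IsOpen (prodSource D) := by
  refine isOpenMap_symMk _ ?_
  simp only [ofPred_forall]
  exact isOpen_iInter_of_finite fun i => (D i).open_source.preimage (continuous_apply i)

/-- Up to a permutation, each entry lies in exactly one of the disjoint domains. There the zero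
extension is either the coordinate itself or identically zero, so its jumps elsewhere do not matter.
-/
theorem contMDiffOn_prodCoord_symMk [IsManifold 𝓘(ℂ, ℂ) ω X]
    {D : Fin k → OpenPartialHomeomorph X ℂ}
    (hD : Pairwise fun i j => Disjoint (D i).source (D j).source)
    (hmem : ∀ i, D i ∈ IsManifold.maximalAtlas 𝓘(ℂ, ℂ) ω X) (i : Fin k) :
    ContMDiffOn (ModelWithCorners.pi fun _ : Fin k => 𝓘(ℂ, ℂ)) 𝓘(ℂ, ℂ) ω
      ((fun z => prodCoord D z i) ∘ symMk) (symMk ⁻¹' prodSource D) := by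
  have h0 : (fun z => prodCoord D z i) ∘ symMk = fun v => ∑ j, extendZero (D i) (v j) :=
    funext fun v => prodCoord_symMk_eq_sum D v i
  rw [h0]
  intro v hv
  obtain ⟨w, hw, hwv⟩ := hv
  obtain ⟨σ, hσ⟩ := symMk_eq_symMk_iff.1 hwv.symm
  refine ContMDiffAt.contMDiffWithinAt (contMDiffAt_finsetSum fun j _ => ?_)
  refine ContMDiffAt.comp (I' := 𝓘(ℂ, ℂ)) (g := extendZero (D i)) v ?_ (contMDiffAt_pi_apply v j)
  rw [hσ]
  by_cases hij : i = σ j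
  · exact contMDiffAt_extendZero (hmem i) (by rw [hij]; exact hw (σ j))
  · exact contMDiffAt_extendZero_of_disjoint (D (σ j)).open_source (hD hij) (hw (σ j))

/-- Near `[z₁, …, z_k]` with distinct `zᵢ`, coordinates of `X` near the points `zᵢ` are coordinates
of `Sym^k(X)`. -/
def prodChart [IsManifold 𝓘(ℂ, ℂ) ω X] (D : Fin k → OpenPartialHomeomorph X ℂ)
    (hD : Pairwise fun i j => Disjoint (D i).source (D j).source)
    (hmem : ∀ i, D i ∈ IsManifold.maximalAtlas 𝓘(ℂ, ℂ) ω X) :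
    OpenPartialHomeomorph (Sym X k) (Fin k → ℂ) where
  toFun := prodCoord D
  invFun w := symMk fun i => (D i).symm (w i)
  source := prodSource D
  target := {w | ∀ i, w i ∈ (D i).target}
  map_source' := by
    rintro _ ⟨v, hv, rfl⟩ i
    rw [prodCoord_symMk hD hv]
    exact (D i).map_source (hv i)
  map_target' w hw := ⟨_, fun i => (D i).map_target (hw i), rfl⟩
  left_inv' := by
    rintro _ ⟨v, hv, rfl⟩
    congr 1
    funext i
    rw [prodCoord_symMk hD hv]
    exact (D i).left_inv (hv i)
  right_inv' w hw := by
    funext i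
    rw [prodCoord_symMk hD fun i => (D i).map_target (hw i)]
    exact (D i).right_inv (hw i)
  open_source := isOpen_prodSource D
  open_target := by
    simp only [ofPred_forall]
    exact isOpen_iInter_of_finite fun i => (D i).open_target.preimage (continuous_apply i)
  continuousOn_toFun := continuousOn_pi.2 fun i => (continuousOn_sym_iff (isOpen_prodSource D)).2
    (contMDiffOn_prodCoord_symMk hD hmem i).continuousOn
  continuousOn_invFun := continuous_symMk.comp_continuousOn <| continuousOn_pi.2 fun i =>
    (D i).continuousOn_symm.comp (continuous_apply i).continuousOn fun w hw => hw i

/-- The coordinates are holomorphic because their pullbacks are, and the inverse is a product of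
holomorphic maps followed by `symMk`. -/
theorem prodChart_mem_maximalAtlas [IsManifold 𝓘(ℂ, ℂ) ω X] (H : IsSymComplexStructure cs)
    {D : Fin k → OpenPartialHomeomorph X ℂ}
    (hD : Pairwise fun i j => Disjoint (D i).source (D j).source)
    (hmem : ∀ i, D i ∈ IsManifold.maximalAtlas 𝓘(ℂ, ℂ) ω X) :
    prodChart D hD hmem ∈ IsManifold.maximalAtlas 𝓘(ℂ, Fin k → ℂ) ω (Sym X k) := by
  have := H.isManifold
  refine OpenPartialHomeomorph.mem_maximalAtlas_of_contMDiffOn _ ?_ ?_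
  · refine contMDiffOn_pi_space.2 fun i => ?_
    exact (H.contMDiffOn_iff _ (isOpen_prodSource D) _).2 (contMDiffOn_prodCoord_symMk hD hmem i)
  · intro w hw
    refine ContMDiffAt.contMDiffWithinAt ?_
    refine ContMDiffAt.comp (I' := ModelWithCorners.pi fun _ : Fin k => 𝓘(ℂ, ℂ))
      (g := symMk) (f := fun (w : Fin k → ℂ) i => (D i).symm (w i)) w
      (H.contMDiff_symMk _) (contMDiffAt_pi_iff.2 fun i => ?_)
    exact ContMDiffAt.comp (I' := 𝓘(ℂ, ℂ)) w (contMDiffAt_symm_of_mem_maximalAtlas (hmem i) (hw i))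
      (contDiff_apply ℂ ℂ i).contDiffAt.contMDiffAt

end IsSymComplexStructure

/-! ### Critical points -/

section Critical

variable {k : ℕ} {M : Type*} [TopologicalSpace M] [ChartedSpace (Fin k → ℂ) M]

/-- Along a holomorphic curve which is constant to order `N` at a critical point, a function is
constant to higher order. -/
theorem isLittleO_of_mem_criticalSet {f : M → ℂ}
    (hf : ContMDiff 𝓘(ℂ, Fin k → ℂ) 𝓘(ℂ, ℂ) ω f) {a : ℂ → M}
    (ha : ContinuousAt a 0) (hz : a 0 ∈ criticalSet k f) {N : ℕ}
    (hO : (fun s => extChartAt 𝓘(ℂ, Fin k → ℂ) (a 0) (a s) -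
      extChartAt 𝓘(ℂ, Fin k → ℂ) (a 0) (a 0)) =O[𝓝 0] fun s => s ^ N) :
    (fun s => f (a s) - f (a 0)) =o[𝓝 0] fun s => s ^ N := by
  set φ := extChartAt 𝓘(ℂ, Fin k → ℂ) (a 0) with hφ
  have h1 : HasMFDerivAt 𝓘(ℂ, Fin k → ℂ) 𝓘(ℂ, ℂ) f (a 0) 0 := by
    have := (hf.mdifferentiable (by simp) (a 0)).hasMFDerivAt
    rwa [show mfderiv 𝓘(ℂ, Fin k → ℂ) 𝓘(ℂ, ℂ) f (a 0) = 0 from hz] at this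
  have h2 : HasFDerivAt (f ∘ φ.symm) (0 : (Fin k → ℂ) →L[ℂ] ℂ) (φ (a 0)) := by
    have : HasFDerivWithinAt (f ∘ φ.symm) (0 : (Fin k → ℂ) →L[ℂ] ℂ) (range 𝓘(ℂ, Fin k → ℂ))
      (φ (a 0)) := h1.2
    rw [modelWithCornersSelf_coe, range_id, hasFDerivWithinAt_univ] at this
    exact this
  have h3 := h2.isLittleO
  simp only [zero_apply, sub_zero, Function.comp_apply] at h3
  have hc : Tendsto (fun s => φ (a s)) (𝓝 0) (𝓝 (φ (a 0))) :=
    (continuousAt_extChartAt (I := 𝓘(ℂ, Fin k → ℂ)) (a 0)).tendsto.comp ha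
  refine ((h3.comp_tendsto hc).trans_isBigO hO).congr' ?_ EventuallyEq.rfl
  filter_upwards [ha.eventually (extChartAt_source_mem_nhds (I := 𝓘(ℂ, Fin k → ℂ)) (a 0))] with s hs
  simp only [Function.comp_apply]
  rw [φ.left_inv hs, φ.left_inv (mem_extChartAt_source (I := 𝓘(ℂ, Fin k → ℂ)) (a 0))]

theorem not_isLittleO_pow {N : ℕ} {c : ℂ} (hc : c ≠ 0) :
    ¬ (fun s : ℂ => c * s ^ N) =o[𝓝 0] fun s => s ^ N := by
  intro h
  have h1 := (h.const_mul_left c⁻¹)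
  simp only [inv_mul_cancel_left₀ hc] at h1
  refine Asymptotics.isLittleO_irrefl ?_ h1
  have h2 : ∃ᶠ s : ℂ in 𝓝[≠] 0, s ∈ ({0}ᶜ : Set ℂ) := eventually_mem_nhdsWithin.frequently
  exact (h2.filter_mono nhdsWithin_le_nhds).mono fun s hs => pow_ne_zero N hs

theorem analyticAt_extChartAt_comp_curve [IsManifold 𝓘(ℂ, Fin k → ℂ) ω M] {a : ℂ → M}
    (ha : ContMDiffAt 𝓘(ℂ, ℂ) 𝓘(ℂ, Fin k → ℂ) ω a 0) :
    AnalyticAt ℂ (fun s => extChartAt 𝓘(ℂ, Fin k → ℂ) (a 0) (a s)) 0 := by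
  have h : ContMDiffAt 𝓘(ℂ, ℂ) 𝓘(ℂ, Fin k → ℂ) ω
      (extChartAt 𝓘(ℂ, Fin k → ℂ) (a 0) ∘ a) 0 := (contMDiffAt_iff_target.1 ha).2
  exact h.contDiffAt.analyticAt

/-- At a critical point a function is constant to first order along curves. -/
theorem curve_order_one [IsManifold 𝓘(ℂ, Fin k → ℂ) ω M] {f : M → ℂ}
    (hf : ContMDiff 𝓘(ℂ, Fin k → ℂ) 𝓘(ℂ, ℂ) ω f) {a : ℂ → M}
    (ha : ContMDiffAt 𝓘(ℂ, ℂ) 𝓘(ℂ, Fin k → ℂ) ω a 0) (hz : a 0 ∈ criticalSet k f) :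
    (fun s => f (a s) - f (a 0)) =o[𝓝 0] fun s => s ^ 1 := by
  refine isLittleO_of_mem_criticalSet hf ha.continuousAt hz ?_
  have h := (analyticAt_extChartAt_comp_curve ha).differentiableAt.isBigO_sub
  simpa using h

/-- At a critical point a function is constant to second order along even curves. -/
theorem curve_order_two [IsManifold 𝓘(ℂ, Fin k → ℂ) ω M] {f : M → ℂ}
    (hf : ContMDiff 𝓘(ℂ, Fin k → ℂ) 𝓘(ℂ, ℂ) ω f) {a : ℂ → M}
    (ha : ContMDiffAt 𝓘(ℂ, ℂ) 𝓘(ℂ, Fin k → ℂ) ω a 0) (heven : ∀ s, a (-s) = a s)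
    (hz : a 0 ∈ criticalSet k f) :
    (fun s => f (a s) - f (a 0)) =o[𝓝 0] fun s => s ^ 2 := by
  refine isLittleO_of_mem_criticalSet hf ha.continuousAt hz ?_
  set b : ℂ → Fin k → ℂ := fun s => extChartAt 𝓘(ℂ, Fin k → ℂ) (a 0) (a s) with hb
  have hbe : ∀ s, b (-s) = b s := fun s => by simp only [hb, heven]
  obtain ⟨q, hq⟩ : AnalyticAt ℂ b 0 := analyticAt_extChartAt_comp_curve ha
  have hO := hq.isBigO_sub_partialSum_pow 2
  have h0 : q.coeff 0 = b 0 := hq.coeff_zero _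
  simp only [zero_add, FormalMultilinearSeries.partialSum, Finset.sum_range_succ,
    Finset.sum_range_zero, FormalMultilinearSeries.apply_eq_pow_smul_coeff, pow_zero, one_smul,
    pow_one, h0] at hO
  have hOneg := hO.comp_tendsto (show Tendsto (fun s : ℂ => -s) (𝓝 0) (𝓝 0) by
    simpa using (continuous_neg (G := ℂ)).tendsto 0)
  -- Averaging the Taylor expansions at `s` and `-s` cancels the linear term, leaving `b s - b 0 =
  -- O(s²)`.
  have hsum := (hO.add (hOneg.congr_right (g₂ := fun s : ℂ => ‖s‖ ^ 2) fun s => by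
    simp)).const_smul_left (2⁻¹ : ℂ)
  refine (hsum.congr_left fun s => ?_).trans (Asymptotics.isBigO_of_le _ fun s => by simp)
  simp only [Function.comp_apply, hbe, Pi.smul_apply]
  module

theorem hasFDerivAt_sum_sq (c : ℂ) : HasFDerivAt (fun w : Fin k → ℂ => c + ∑ i, w i ^ 2)
    (0 : (Fin k → ℂ) →L[ℂ] ℂ) 0 := by
  have h : ∀ i : Fin k, HasFDerivAt (fun w : Fin k → ℂ => w i ^ 2)
      (0 : (Fin k → ℂ) →L[ℂ] ℂ) 0 := fun i => by
    have := (ContinuousLinearMap.proj (R := ℂ) (φ := fun _ : Fin k => ℂ) i).hasFDerivAt.pow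
      (x := (0 : Fin k → ℂ)) 2
    exact this.congr_fderiv (by ext; simp)
  have h2 := (HasFDerivAt.fun_sum fun i (_ : i ∈ Finset.univ) => h i).const_add c
  simpa using h2

/-- The origin of a Morse chart is a critical point. -/
theorem mem_criticalSet_of_morse_chart [IsManifold 𝓘(ℂ, Fin k → ℂ) ω M] {f : M → ℂ} {z : M}
    {e : OpenPartialHomeomorph M (Fin k → ℂ)}
    (he : e ∈ IsManifold.maximalAtlas 𝓘(ℂ, Fin k → ℂ) ω M) (hz : z ∈ e.source) (h0 : e z = 0)
    (hf : ∀ x ∈ e.source, f x = f z + ∑ i, e x i ^ 2) : z ∈ criticalSet k f := by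
  have h1 : HasMFDerivAt 𝓘(ℂ, Fin k → ℂ) 𝓘(ℂ, ℂ) (fun w : Fin k → ℂ => f z + ∑ i, w i ^ 2) (e z)
      (0 : (Fin k → ℂ) →L[ℂ] ℂ) := by
    rw [h0]
    exact (hasFDerivAt_sum_sq (f z)).hasMFDerivAt
  have h2 := ((contMDiffAt_of_mem_maximalAtlas he hz).mdifferentiableAt (by simp)).hasMFDerivAt
  have h3 := (h1.comp z h2).congr_of_eventuallyEq (f₁ := f) (by
    filter_upwards [e.open_source.mem_nhds hz] with x hx using hf x hx)
  have h4 := h3.mfderiv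
  change mfderiv 𝓘(ℂ, Fin k → ℂ) 𝓘(ℂ, ℂ) f z = 0
  rw [h4]
  exact ContinuousLinearMap.zero_comp _

/-- The origin of a Morse chart is a nondegenerate critical point. -/
theorem isNondegenerateCriticalPoint_of_morse_chart [IsManifold 𝓘(ℂ, Fin k → ℂ) ω M] {f : M → ℂ}
    {z : M} {e : OpenPartialHomeomorph M (Fin k → ℂ)}
    (he : e ∈ IsManifold.maximalAtlas 𝓘(ℂ, Fin k → ℂ) ω M) (hz : z ∈ e.source) (h0 : e z = 0)
    (hf : ∀ x ∈ e.source, f x = f z + ∑ i, e x i ^ 2) : IsNondegenerateCriticalPoint k f z := by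
  refine ⟨mem_criticalSet_of_morse_chart he hz h0 hf, fun e' he' hz' u hu => ?_⟩
  have hφ : ContDiffAt ℂ ω (e ∘ e'.symm) (e' z) := by
    have h1 : ContMDiffAt 𝓘(ℂ, Fin k → ℂ) 𝓘(ℂ, Fin k → ℂ) ω e (e'.symm (e' z)) := by
      rw [e'.left_inv hz']
      exact contMDiffAt_of_mem_maximalAtlas he hz
    exact (h1.comp _ (contMDiffAt_symm_of_mem_maximalAtlas he' (e'.map_source hz'))).contDiffAt
  have hψ : ContDiffAt ℂ ω (e' ∘ e.symm) (e z) := by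
    have h1 : ContMDiffAt 𝓘(ℂ, Fin k → ℂ) 𝓘(ℂ, Fin k → ℂ) ω e' (e.symm (e z)) := by
      rw [e.left_inv hz]
      exact contMDiffAt_of_mem_maximalAtlas he' hz'
    exact (h1.comp _ (contMDiffAt_symm_of_mem_maximalAtlas he (e.map_source hz))).contDiffAt
  set φ := e ∘ e'.symm with hφdef
  set ψ := e' ∘ e.symm with hψdef
  have hφz : φ (e' z) = e z := congrArg e (e'.left_inv hz')
  have hψz : ψ (e z) = e' z := congrArg e' (e.left_inv hz)
  have hmem : ∀ᶠ x in 𝓝 (e' z), e'.symm x ∈ e.source ∧ x ∈ e'.target := by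
    refine (Tendsto.eventually (f := e'.symm) (p := fun y => y ∈ e.source)
      (e'.continuousAt_symm (e'.map_source hz')) ?_).and (e'.open_target.mem_nhds (e'.map_source hz'))
    rw [e'.left_inv hz']
    exact e.open_source.mem_nhds hz
  have hmem' : ∀ᶠ x in 𝓝 (e z), e.symm x ∈ e'.source ∧ x ∈ e.target := by
    refine (Tendsto.eventually (f := e.symm) (p := fun y => y ∈ e'.source)
      (e.continuousAt_symm (e.map_source hz)) ?_).and (e.open_target.mem_nhds (e.map_source hz))
    rw [e.left_inv hz]
    exact e'.open_source.mem_nhds hz'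
  have hdφ : HasFDerivAt φ (fderiv ℂ φ (e' z)) (e' z) :=
    (hφ.differentiableAt (by simp)).hasFDerivAt
  have hdψ : HasFDerivAt ψ (fderiv ℂ ψ (e z)) (e z) :=
    (hψ.differentiableAt (by simp)).hasFDerivAt
  have hψφ : ∀ w, fderiv ℂ ψ (e z) (fderiv ℂ φ (e' z) w) = w := by
    rw [← hφz] at hdψ
    have h1 := (hdψ.comp (e' z) hdφ).congr_of_eventuallyEq (f₁ := id) (by
      filter_upwards [hmem] with x hx
      simp only [hφdef, hψdef, Function.comp_apply, id]
      rw [e.left_inv hx.1, e'.right_inv hx.2])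
    intro w
    have h2 := h1.unique (hasFDerivAt_id (e' z))
    rw [hφz] at h2
    exact congrArg (fun L : (Fin k → ℂ) →L[ℂ] (Fin k → ℂ) => L w) h2
  have hφψ : ∀ w, fderiv ℂ φ (e' z) (fderiv ℂ ψ (e z) w) = w := by
    rw [← hψz] at hdφ
    have h1 := (hdφ.comp (e z) hdψ).congr_of_eventuallyEq (f₁ := id) (by
      filter_upwards [hmem'] with x hx
      simp only [hφdef, hψdef, Function.comp_apply, id]
      rw [e'.left_inv hx.1, e.right_inv hx.2])
    intro w
    have h2 := h1.unique (hasFDerivAt_id (e z))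
    rw [hψz] at h2
    exact congrArg (fun L : (Fin k → ℂ) →L[ℂ] (Fin k → ℂ) => L w) h2
  -- the first derivative near the point
  have hcoord : ∀ x, DifferentiableAt ℂ φ x → ∀ i, HasFDerivAt (fun x => φ x i)
      ((ContinuousLinearMap.proj (R := ℂ) (φ := fun _ : Fin k => ℂ) i).comp (fderiv ℂ φ x)) x :=
    fun x hx i => (ContinuousLinearMap.proj (R := ℂ)
      (φ := fun _ : Fin k => ℂ) i).hasFDerivAt.comp x hx.hasFDerivAt
  have hev : f ∘ e'.symm =ᶠ[𝓝 (e' z)] fun x => f z + ∑ i, φ x i ^ 2 := by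
    filter_upwards [hmem] with x hx using hf _ hx.1
  have hD : fderiv ℂ (f ∘ e'.symm) =ᶠ[𝓝 (e' z)] fun x => ∑ i, (2 * φ x i) •
      (ContinuousLinearMap.proj (R := ℂ) (φ := fun _ : Fin k => ℂ) i).comp (fderiv ℂ φ x) := by
    refine hev.fderiv.trans ?_
    have hdiff : ∀ᶠ x in 𝓝 (e' z), DifferentiableAt ℂ φ x :=
      (hφ.analyticAt.eventually_analyticAt).mono fun x hx => hx.differentiableAt
    filter_upwards [hdiff] with x hx
    have := ((HasFDerivAt.fun_sum fun i (_ : i ∈ Finset.univ) =>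
      (hcoord x hx i).pow 2).const_add (f z)).fderiv
    rw [this]
    refine Finset.sum_congr rfl fun i _ => ?_
    simp
  -- The terms containing the second derivative of `φ` carry a factor `φ i`, which vanishes at the
  -- centre. The Hessian is therefore `2 ∑ dφᵢ ⊗ dφᵢ`.
  have hDD : HasFDerivAt (fderiv ℂ (f ∘ e'.symm)) (∑ i, ((2 : ℂ) •
      (ContinuousLinearMap.proj (R := ℂ) (φ := fun _ : Fin k => ℂ) i).comp
        (fderiv ℂ φ (e' z))).smulRight
      ((ContinuousLinearMap.proj (R := ℂ) (φ := fun _ : Fin k => ℂ) i).comp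
        (fderiv ℂ φ (e' z)))) (e' z) := by
    refine HasFDerivAt.congr_of_eventuallyEq ?_ hD
    refine HasFDerivAt.fun_sum fun i _ => ?_
    have h1 := (hcoord (e' z) hdφ.differentiableAt i).const_mul (2 : ℂ)
    have h2 : DifferentiableAt ℂ (fun x =>
        (ContinuousLinearMap.proj (R := ℂ) (φ := fun _ : Fin k => ℂ) i).comp (fderiv ℂ φ x))
        (e' z) := by
      refine (differentiableAt_const _).clm_comp ?_
      exact hφ.analyticAt.fderiv.differentiableAt
    have h3 := h1.smul h2.hasFDerivAt
    have h4 : φ (e' z) i = 0 := by rw [hφz, h0]; rfl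
    rw [h4, mul_zero, zero_smul, zero_add] at h3
    exact h3
  have hz0 : fderiv ℂ φ (e' z) u = 0 := by
    funext i
    -- Pairing with the vector that `dφ` sends to the `i`-th basis vector isolates twice the `i`-th
    -- component of `dφ u`.
    have h1 := hu (fderiv ℂ ψ (e z) (Pi.single i 1))
    rw [hDD.fderiv] at h1
    simp only [sum_apply, ContinuousLinearMap.smulRight_apply,
      smul_apply, ContinuousLinearMap.comp_apply, ContinuousLinearMap.proj_apply,
      hφψ, smul_eq_mul] at h1
    rw [Finset.sum_eq_single i] at h1
    · simpa using h1
    · intro j _ hj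
      simp [Pi.single_eq_of_ne hj]
    · simp
  rw [← hψφ u, hz0, map_zero]

end Critical

namespace DoubleCover

variable {n : ℕ} {p : Fin n ↪ ℂ}

/-! ### Coordinates on the double cover -/

instance : T2Space (DoubleCover p) :=
  inferInstanceAs (T2Space {z : ℂ × ℂ // z.2 ^ 2 = branchPoly p z.1})

theorem proj_surjective : Function.Surjective (proj (p := p)) := by
  intro x
  obtain ⟨y, hy⟩ := IsAlgClosed.exists_pow_nat_eq (branchPoly p x) two_pos
  exact ⟨⟨(x, y), hy⟩, rfl⟩

instance : Nonempty (DoubleCover p) := ⟨(proj_surjective 0).choose⟩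

theorem contMDiff_proj : ContMDiff 𝓘(ℂ, ℂ) 𝓘(ℂ, ℂ) ω (proj (p := p)) := by
  intro z
  rw [contMDiffAt_iff_source]
  have h1 : z ∈ (chart z).source := mem_chart_source ℂ z
  have h2 := (contDiffOn_proj_chart_symm z).contDiffAt
    ((chart z).open_target.mem_nhds ((chart z).map_source h1))
  exact h2.contMDiffAt.contMDiffWithinAt

theorem contMDiff_snd : ContMDiff 𝓘(ℂ, ℂ) 𝓘(ℂ, ℂ) ω (snd (p := p)) := by
  intro z
  rw [contMDiffAt_iff_source]
  have h1 : z ∈ (chart z).source := mem_chart_source ℂ z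
  have h2 := (contDiffOn_snd_chart_symm z).contDiffAt
    ((chart z).open_target.mem_nhds ((chart z).map_source h1))
  exact h2.contMDiffAt.contMDiffWithinAt

/-- A map into the double cover is holomorphic if its two components are. -/
theorem contMDiffAt_of_proj_snd {f : ℂ → DoubleCover p} {s : ℂ}
    (h1 : AnalyticAt ℂ (fun s => (f s).proj) s) (h2 : AnalyticAt ℂ (fun s => (f s).snd) s) :
    ContMDiffAt 𝓘(ℂ, ℂ) 𝓘(ℂ, ℂ) ω f s := by
  rw [contMDiffAt_iff_target]
  constructor
  · exact (Topology.IsInducing.subtypeVal.continuousAt_iff).2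
      (h1.continuousAt.prodMk h2.continuousAt)
  · change ContMDiffAt 𝓘(ℂ, ℂ) 𝓘(ℂ, ℂ) ω (chart (f s) ∘ f) s
    unfold chart
    split_ifs with h
    · exact h2.contDiffAt.contMDiffAt
    · exact h1.contDiffAt.contMDiffAt

theorem exists_eq_branchPoint {z : DoubleCover p} (hz : z.snd = 0) : ∃ j, z = branchPoint p j := by
  have h : branchPoly p z.proj = 0 := by rw [← snd_sq, hz]; simp
  obtain ⟨j, -, hj⟩ := Finset.prod_eq_zero_iff.1 h
  exact ⟨j, (proj_eq_iff z j).1 (sub_eq_zero.1 hj)⟩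

theorem proj_branchPoint (j : Fin n) : (branchPoint p j).proj = p j := rfl

theorem snd_branchPoint (j : Fin n) : (branchPoint p j).snd = 0 := rfl

theorem branchPoint_injective : Function.Injective (branchPoint p) := fun _ _ h =>
  p.injective (congrArg proj h)

/-- Through a point which is not a ramification point there is a holomorphic curve along which the
function `x` is a coordinate. -/
theorem exists_unramified_curve {z : DoubleCover p} (hz : z.snd ≠ 0) :
    ∃ a : ℂ → DoubleCover p, ContMDiffAt 𝓘(ℂ, ℂ) 𝓘(ℂ, ℂ) ω a 0 ∧ a 0 = z ∧
      ∀ s, (a s).proj = z.proj + s := by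
  have hsrc : z ∈ (projChart p z.snd hz).source := by
    change 0 < (z.snd / z.snd).re
    simp [div_self hz]
  have hchart : chart z = projChart p z.snd hz := dif_neg hz
  refine ⟨fun s => (projChart p z.snd hz).symm (z.proj + s), ?_, ?_, fun s => rfl⟩
  · have h1 : ContMDiffAt 𝓘(ℂ, ℂ) 𝓘(ℂ, ℂ) ω (chart z).symm (z.proj + 0) := by
      refine contMDiffAt_symm_of_mem_maximalAtlas (IsManifold.chart_mem_maximalAtlas z) ?_
      change z.proj + 0 ∈ (chart z).target
      rw [hchart, add_zero]
      exact (projChart p z.snd hz).map_source hsrc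
    rw [hchart] at h1
    refine ContMDiffAt.comp (I' := 𝓘(ℂ, ℂ)) (f := fun s : ℂ => z.proj + s) 0 h1 ?_
    exact (contDiff_const.add contDiff_id).contDiffAt.contMDiffAt
  · simp only [add_zero]
    exact (projChart p z.snd hz).left_inv hsrc

/-- The product `∏ (x - pᵢ)` over `i ≠ j`. -/
def cofactor (p : Fin n ↪ ℂ) (j : Fin n) (x : ℂ) : ℂ := ∏ i ∈ Finset.univ.erase j, (x - p i)

theorem branchPoly_eq (j : Fin n) (x : ℂ) : branchPoly p x = (x - p j) * cofactor p j x :=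
  (Finset.mul_prod_erase _ _ (Finset.mem_univ j)).symm

theorem cofactor_ne_zero (j : Fin n) : cofactor p j (p j) ≠ 0 :=
  Finset.prod_ne_zero_iff.2 fun _ hi h =>
    (Finset.mem_erase.1 hi).1 (p.injective (sub_eq_zero.1 h)).symm

theorem analyticAt_cofactor (j : Fin n) (x : ℂ) : AnalyticAt ℂ (cofactor p j) x := by
  have : ContDiff ℂ ω (cofactor p j) := contDiff_prod fun i _ => contDiff_id.sub contDiff_const
  exact this.contDiffAt.analyticAt

/-- A branch of the square root of `cofactor p j`, holomorphic near `p j`. -/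
def sqrtCofactor (p : Fin n ↪ ℂ) (j : Fin n) (x : ℂ) : ℂ :=
  cofactor p j (p j) ^ (1 / 2 : ℂ) * (cofactor p j x / cofactor p j (p j)) ^ (1 / 2 : ℂ)

/-- The principal square root squares to its argument everywhere, so this holds without restricting
`x`. Only holomorphy needs the slit plane, and dividing by the value at `p j` places that point
safely inside it. -/
theorem sqrtCofactor_sq (j : Fin n) (x : ℂ) : sqrtCofactor p j x ^ 2 = cofactor p j x := by
  have h : ∀ w : ℂ, (w ^ (1 / 2 : ℂ)) ^ 2 = w := fun w => by
    rw [← Complex.cpow_nat_mul]; simp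
  rw [sqrtCofactor, mul_pow, h, h, mul_div_cancel₀ _ (cofactor_ne_zero j)]

/-- The domain of holomorphy of `sqrtCofactor p j`. -/
def sqrtDomain (p : Fin n ↪ ℂ) (j : Fin n) : Set ℂ :=
  {x | cofactor p j x / cofactor p j (p j) ∈ Complex.slitPlane}

theorem isOpen_sqrtDomain (j : Fin n) : IsOpen (sqrtDomain p j) :=
  Complex.isOpen_slitPlane.preimage
    ((continuous_iff_continuousAt.2 fun x => (analyticAt_cofactor j x).continuousAt).div_const _)

theorem mem_sqrtDomain (j : Fin n) : p j ∈ sqrtDomain p j := by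
  change cofactor p j (p j) / cofactor p j (p j) ∈ Complex.slitPlane
  rw [div_self (cofactor_ne_zero j)]
  exact Complex.one_mem_slitPlane

theorem analyticAt_sqrtCofactor {j : Fin n} {x : ℂ} (hx : x ∈ sqrtDomain p j) :
    AnalyticAt ℂ (sqrtCofactor p j) x :=
  analyticAt_const.mul (((analyticAt_cofactor j x).div analyticAt_const
    (cofactor_ne_zero j)).cpow analyticAt_const hx)

theorem sqrtCofactor_ne_zero {j : Fin n} {x : ℂ} (hx : x ∈ sqrtDomain p j) :
    sqrtCofactor p j x ≠ 0 := by
  intro h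
  have h1 := sqrtCofactor_sq (p := p) j x
  rw [h] at h1
  have h2 : cofactor p j x / cofactor p j (p j) ≠ 0 := Complex.slitPlane_ne_zero hx
  exact h2 (by rw [← h1]; simp)

/-- The parametrization of the double cover near a branch point with `x = pⱼ + s²`. -/
def branchCurve (p : Fin n ↪ ℂ) (j : Fin n) (s : ℂ) : DoubleCover p :=
  ⟨(p j + s ^ 2, s * sqrtCofactor p j (p j + s ^ 2)), by
    rw [branchPoly_eq j, mul_pow, sqrtCofactor_sq]
    ring⟩

theorem proj_branchCurve (j : Fin n) (s : ℂ) : (branchCurve p j s).proj = p j + s ^ 2 := rfl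

theorem snd_branchCurve (j : Fin n) (s : ℂ) :
    (branchCurve p j s).snd = s * sqrtCofactor p j (p j + s ^ 2) := rfl

theorem branchCurve_zero (j : Fin n) : branchCurve p j 0 = branchPoint p j := by
  rw [← proj_eq_iff, proj_branchCurve]
  simp

theorem contMDiffAt_branchCurve {j : Fin n} {s : ℂ} (hs : p j + s ^ 2 ∈ sqrtDomain p j) :
    ContMDiffAt 𝓘(ℂ, ℂ) 𝓘(ℂ, ℂ) ω (branchCurve p j) s := by
  have h1 : AnalyticAt ℂ (fun s : ℂ => p j + s ^ 2) s := by fun_prop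
  exact contMDiffAt_of_proj_snd h1 (analyticAt_id.mul
    (AnalyticAt.comp (g := sqrtCofactor p j) (analyticAt_sqrtCofactor hs) h1))

/-- The function `√(x - pⱼ)`, continued holomorphically through the branch point. -/
def branchCoord (p : Fin n ↪ ℂ) (j : Fin n) (z : DoubleCover p) : ℂ :=
  z.snd / sqrtCofactor p j z.proj

/-- Divide `y² = (x - pⱼ) * cofactor` by the cofactor. This identity is the source of the squares in
the Morse chart. -/
theorem proj_eq_add_branchCoord_sq {j : Fin n} {z : DoubleCover p}
    (hz : z.proj ∈ sqrtDomain p j) : z.proj = p j + branchCoord p j z ^ 2 := by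
  have h := sqrtCofactor_ne_zero hz
  rw [branchCoord, div_pow, snd_sq, branchPoly_eq j, ← sqrtCofactor_sq]
  field_simp
  ring

theorem contMDiffAt_branchCoord {j : Fin n} {z : DoubleCover p} (hz : z.proj ∈ sqrtDomain p j) :
    ContMDiffAt 𝓘(ℂ, ℂ) 𝓘(ℂ, ℂ) ω (branchCoord p j) z := by
  have h1 : ContMDiffAt 𝓘(ℂ, ℂ) 𝓘(ℂ, ℂ) ω (fun z : DoubleCover p => (sqrtCofactor p j z.proj)⁻¹) z :=
    ContMDiffAt.comp (I' := 𝓘(ℂ, ℂ)) (g := fun x => (sqrtCofactor p j x)⁻¹) z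
      ((analyticAt_sqrtCofactor hz).inv (sqrtCofactor_ne_zero hz)).contDiffAt.contMDiffAt
      (contMDiff_proj z)
  have h2 := (contMDiff_snd (p := p) z).mul h1
  exact h2.congr_of_eventuallyEq (Eventually.of_forall fun z => div_eq_mul_inv _ _)

/-- The coordinate `√(x - pⱼ)` near the branch point `qⱼ`. -/
def branchChart (p : Fin n ↪ ℂ) (j : Fin n) : OpenPartialHomeomorph (DoubleCover p) ℂ where
  toFun := branchCoord p j
  invFun := branchCurve p j
  source := {z | z.proj ∈ sqrtDomain p j}
  target := {s | p j + s ^ 2 ∈ sqrtDomain p j}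
  map_source' z hz := by
    change p j + branchCoord p j z ^ 2 ∈ sqrtDomain p j
    rw [← proj_eq_add_branchCoord_sq hz]
    exact hz
  map_target' s hs := hs
  left_inv' z hz := by
    have h := proj_eq_add_branchCoord_sq hz
    refine DoubleCover.ext h.symm ?_
    rw [snd_branchCurve, ← h, branchCoord, div_mul_cancel₀ _ (sqrtCofactor_ne_zero (x := z.proj) hz)]
  right_inv' s hs := by
    change s * sqrtCofactor p j (p j + s ^ 2) / sqrtCofactor p j (p j + s ^ 2) = s
    exact mul_div_cancel_right₀ s (sqrtCofactor_ne_zero (x := p j + s ^ 2) hs)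
  open_source := (isOpen_sqrtDomain j).preimage continuous_proj
  open_target := (isOpen_sqrtDomain j).preimage (by fun_prop)
  continuousOn_toFun _ hz := (contMDiffAt_branchCoord (j := j) hz).continuousAt.continuousWithinAt
  continuousOn_invFun s hs :=
    (contMDiffAt_branchCurve (p := p) (j := j) (s := s) hs).continuousAt.continuousWithinAt

theorem branchChart_mem_maximalAtlas (j : Fin n) :
    branchChart p j ∈ IsManifold.maximalAtlas 𝓘(ℂ, ℂ) ω (DoubleCover p) :=
  OpenPartialHomeomorph.mem_maximalAtlas_of_contMDiffOn _
    (fun _ hz => (contMDiffAt_branchCoord hz).contMDiffWithinAt)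
    (fun s hs => (contMDiffAt_branchCurve (p := p) (j := j) (s := s) hs).contMDiffWithinAt)

end DoubleCover

/-! ### The Lefschetz fibration -/

section Fibration

open DoubleCover

variable {n k : ℕ} {p : Fin n ↪ ℂ}

theorem symProjSum_symMk (v : Fin k → DoubleCover p) :
    symProjSum p k (symMk v) = ∑ i, (v i).proj := by
  change ((Finset.univ.val.map v).map proj).sum = _
  rw [Multiset.map_map]
  rfl

theorem symProjSum_surjective (hk : 1 ≤ k) : Function.Surjective (symProjSum p k) := by
  intro c
  obtain ⟨z, hz⟩ := proj_surjective (p := p) c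
  obtain ⟨w, hw⟩ := proj_surjective (p := p) 0
  refine ⟨symMk (Function.update (fun _ => w) ⟨0, hk⟩ z), ?_⟩
  rw [symProjSum_symMk, Finset.sum_eq_single ⟨0, hk⟩]
  · simpa using hz
  · intro i _ hi
    rw [Function.update_of_ne hi, hw]
  · simp

variable {cs : ChartedSpace (Fin k → ℂ) (Sym (DoubleCover p) k)}

theorem contMDiff_symProjSum (H : IsSymComplexStructure cs) :
    ContMDiff 𝓘(ℂ, Fin k → ℂ) 𝓘(ℂ, ℂ) ω (symProjSum p k) := by
  rw [← contMDiffOn_univ, H.contMDiffOn_iff univ isOpen_univ, preimage_univ, contMDiffOn_univ]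
  have : symProjSum p k ∘ symMk = fun v => ∑ i, (v i).proj := funext symProjSum_symMk
  rw [this]
  intro v
  exact contMDiffAt_finsetSum fun i _ =>
    ContMDiffAt.comp (I' := 𝓘(ℂ, ℂ)) (g := proj) v (contMDiff_proj (v i)) (contMDiffAt_pi_apply v i)

theorem contMDiffAt_update {v : ℂ → Fin k → DoubleCover p} {a : ℂ → DoubleCover p} {s : ℂ}
    (i : Fin k)
    (hv : ContMDiffAt 𝓘(ℂ, ℂ) (ModelWithCorners.pi fun _ : Fin k => 𝓘(ℂ, ℂ)) ω v s)
    (ha : ContMDiffAt 𝓘(ℂ, ℂ) 𝓘(ℂ, ℂ) ω a s) :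
    ContMDiffAt 𝓘(ℂ, ℂ) (ModelWithCorners.pi fun _ : Fin k => 𝓘(ℂ, ℂ)) ω
      (fun s => Function.update (v s) i (a s)) s := by
  refine contMDiffAt_pi_iff.2 fun j => ?_
  by_cases h : j = i
  · subst h
    simpa using ha
  · simpa [Function.update_of_ne h] using contMDiffAt_pi_iff.1 hv j

/-- All the points of a critical tuple are ramification points. -/
theorem snd_eq_zero_of_mem_criticalSet (H : IsSymComplexStructure cs) {v : Fin k → DoubleCover p}
    (hv : symMk v ∈ criticalSet k (symProjSum p k)) (i : Fin k) : (v i).snd = 0 := by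
  by_contra hi
  have := H.isManifold
  -- Moving only the `i`-th entry along this curve changes the sum by exactly `s`, which is not
  -- `o(s)`.
  obtain ⟨a, ha, ha0, hap⟩ := exists_unramified_curve hi
  have hγ0 : symMk (Function.update v i (a 0)) = symMk v := by rw [ha0, Function.update_eq_self]
  have hγ : ContMDiffAt 𝓘(ℂ, ℂ) 𝓘(ℂ, Fin k → ℂ) ω (fun s => symMk (Function.update v i (a s))) 0 :=
    ContMDiffAt.comp (I' := ModelWithCorners.pi fun _ : Fin k => 𝓘(ℂ, ℂ)) 0 (H.contMDiff_symMk _)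
      (contMDiffAt_update i contMDiffAt_const ha)
  have hO := curve_order_one (contMDiff_symProjSum H) hγ (by rw [hγ0]; exact hv)
  refine not_isLittleO_pow one_ne_zero (hO.congr_left fun s => ?_)
  simp only [hγ0]
  rw [symProjSum_symMk, symProjSum_symMk, ← Finset.sum_sub_distrib, Finset.sum_eq_single i]
  · simp [hap]
  · intro j _ hj
    simp [Function.update_of_ne hj]
  · simp

/-- The points of a critical tuple are pairwise distinct. -/
theorem injective_of_mem_criticalSet (H : IsSymComplexStructure cs) {v : Fin k → DoubleCover p}
    (hv : symMk v ∈ criticalSet k (symProjSum p k)) : Function.Injective v := by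
  intro i₁ i₂ h12
  by_contra hne
  have := H.isManifold
  obtain ⟨j, hj⟩ := exists_eq_branchPoint (snd_eq_zero_of_mem_criticalSet H hv i₁)
  -- The two coinciding entries separate in opposite directions. Replacing `s` by `-s` swaps them,
  -- so the curve of unordered tuples is even.
  set γ : ℂ → Fin k → DoubleCover p := fun s =>
    Function.update (Function.update v i₁ (branchCurve p j s)) i₂ (branchCurve p j (-s)) with hγdef
  have hγ0 : γ 0 = v := by
    simp only [hγdef, neg_zero, branchCurve_zero]
    rw [← hj, Function.update_eq_self, h12, Function.update_eq_self]
  have h0 : p j + (0 : ℂ) ^ 2 ∈ sqrtDomain p j := by simpa using mem_sqrtDomain j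
  have hbr := contMDiffAt_branchCurve h0
  have hbrneg : ContMDiffAt 𝓘(ℂ, ℂ) 𝓘(ℂ, ℂ) ω (fun s : ℂ => branchCurve p j (-s)) 0 := by
    refine ContMDiffAt.comp (I' := 𝓘(ℂ, ℂ)) (g := branchCurve p j) (f := fun s : ℂ => -s) 0 ?_
      contDiff_neg.contDiffAt.contMDiffAt
    rw [neg_zero]
    exact hbr
  have hγ : ContMDiffAt 𝓘(ℂ, ℂ) 𝓘(ℂ, Fin k → ℂ) ω (fun s => symMk (γ s)) 0 :=
    ContMDiffAt.comp (I' := ModelWithCorners.pi fun _ : Fin k => 𝓘(ℂ, ℂ)) 0 (H.contMDiff_symMk _)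
      (contMDiffAt_update i₂ (contMDiffAt_update i₁ contMDiffAt_const hbr) hbrneg)
  have heven : ∀ s, symMk (γ (-s)) = symMk (γ s) := by
    intro s
    refine symMk_eq_symMk_iff.2 ⟨Equiv.swap i₁ i₂, ?_⟩
    funext i
    simp only [hγdef, neg_neg, Function.comp_apply]
    by_cases h1 : i = i₁
    · subst h1
      simp [Function.update_of_ne hne]
    · by_cases h2 : i = i₂
      · subst h2
        simp [Function.update_of_ne hne]
      · rw [Equiv.swap_apply_of_ne_of_ne h1 h2]
        simp [Function.update_of_ne h1, Function.update_of_ne h2]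
  have hO := curve_order_two (contMDiff_symProjSum H) hγ heven (by rw [hγ0]; exact hv)
  -- Each moving entry contributes `s²` to the sum, so the total change is `2 s²`, contradicting
  -- `o(s²)`.
  refine not_isLittleO_pow two_ne_zero (hO.congr_left fun s => ?_)
  simp only [hγ0]
  rw [symProjSum_symMk, symProjSum_symMk, ← Finset.sum_sub_distrib,
    Finset.sum_eq_add_of_mem i₁ i₂ (Finset.mem_univ _) (Finset.mem_univ _) hne]
  · rw [← h12, hj]
    simp only [hγdef, Function.update_self, Function.update_of_ne hne, proj_branchCurve,
      proj_branchPoint]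
    ring
  · rintro i - ⟨h1, h2⟩
    simp [hγdef, Function.update_of_ne h1, Function.update_of_ne h2]

/-- The local model of `symProjSum` at a tuple of distinct ramification points. -/
theorem exists_morse_chart (H : IsSymComplexStructure cs) {σ : Fin k → Fin n}
    (hσ : Function.Injective σ) :
    ∃ e ∈ IsManifold.maximalAtlas 𝓘(ℂ, Fin k → ℂ) ω (Sym (DoubleCover p) k),
      symMk (fun i => branchPoint p (σ i)) ∈ e.source ∧
      e (symMk fun i => branchPoint p (σ i)) = 0 ∧
      ∀ x ∈ e.source, symProjSum p k x =
        symProjSum p k (symMk fun i => branchPoint p (σ i)) + ∑ i, e x i ^ 2 := by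
  -- Restricting the branch charts to preimages of discs of radius `r` makes their domains disjoint,
  -- as `prodChart` requires.
  obtain ⟨r, hr, -, hsep⟩ := exists_radius (t₀ := fun i => p (σ i)) one_pos
  have hopen : ∀ i, IsOpen ((proj (p := p)) ⁻¹' Metric.ball (p (σ i)) r) := fun i =>
    Metric.isOpen_ball.preimage continuous_proj
  set D : Fin k → OpenPartialHomeomorph (DoubleCover p) ℂ := fun i =>
    (branchChart p (σ i)).restr (proj ⁻¹' Metric.ball (p (σ i)) r) with hDdef
  have hsrc : ∀ i, (D i).source =
      {z | z.proj ∈ sqrtDomain p (σ i)} ∩ proj ⁻¹' Metric.ball (p (σ i)) r := by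
    intro i
    rw [hDdef]
    simp only
    rw [OpenPartialHomeomorph.restr_source, (hopen i).interior_eq]
    rfl
  have hD : Pairwise fun i j => Disjoint (D i).source (D j).source := by
    intro i j hij
    rw [hsrc, hsrc, disjoint_left]
    rintro z ⟨-, h1⟩ ⟨-, h2⟩
    have h3 := hsep i j fun h => hij (hσ (p.injective h))
    have h4 := dist_triangle_left (p (σ i)) (p (σ j)) z.proj
    have h5 : dist z.proj (p (σ i)) < r := h1
    have h6 : dist z.proj (p (σ j)) < r := h2
    linarith
  have hmem : ∀ i, D i ∈ IsManifold.maximalAtlas 𝓘(ℂ, ℂ) ω (DoubleCover p) := fun i =>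
    restr_mem_maximalAtlas _ (branchChart_mem_maximalAtlas (σ i)) (hopen i)
  have hcenter : ∀ i, branchPoint p (σ i) ∈ (D i).source := by
    intro i
    rw [hsrc]
    exact ⟨mem_sqrtDomain (σ i), Metric.mem_ball_self hr⟩
  refine ⟨IsSymComplexStructure.prodChart D hD hmem,
    IsSymComplexStructure.prodChart_mem_maximalAtlas H hD hmem, ⟨_, hcenter, rfl⟩, ?_, ?_⟩
  · funext i
    refine (IsSymComplexStructure.prodCoord_symMk hD hcenter i).trans ?_
    change branchCoord p (σ i) (branchPoint p (σ i)) = 0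
    simp [branchCoord, snd_branchPoint]
  · rintro _ ⟨v, hv, rfl⟩
    rw [symProjSum_symMk, symProjSum_symMk, ← Finset.sum_add_distrib]
    refine Finset.sum_congr rfl fun i _ => ?_
    have h1 : (IsSymComplexStructure.prodChart D hD hmem) (symMk v) i = D i (v i) :=
      IsSymComplexStructure.prodCoord_symMk hD hv i
    rw [h1]
    have h2 := hv i
    rw [hsrc] at h2
    exact proj_eq_add_branchCoord_sq h2.1

/-- Tuples of pairwise distinct ramification points. -/
theorem nodup_and_forall_branchPoint_iff {v : Fin k → DoubleCover p} :
    (((symMk v : Sym (DoubleCover p) k) : Multiset (DoubleCover p)).Nodup ∧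
      ∀ w ∈ (symMk v : Sym (DoubleCover p) k), ∃ j : Fin n, w = branchPoint p j) ↔
    ∃ σ : Fin k → Fin n, Function.Injective σ ∧ v = fun i => branchPoint p (σ i) := by
  have h1 : ((symMk v : Sym (DoubleCover p) k) : Multiset (DoubleCover p)).Nodup ↔
      Function.Injective v := by
    change (Finset.univ.val.map v).Nodup ↔ _
    rw [Multiset.nodup_map_iff_inj_on Finset.univ.nodup]
    simp [Function.Injective]
  rw [h1, forall_mem_symMk (q := fun w => ∃ j : Fin n, w = branchPoint p j)]
  constructor
  · rintro ⟨h2, h3⟩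
    choose σ hσ using h3
    refine ⟨σ, fun i j hij => h2 ?_, funext hσ⟩
    rw [hσ i, hσ j, hij]
  · rintro ⟨σ, hσ, rfl⟩
    exact ⟨branchPoint_injective.comp hσ, fun i => ⟨σ i, rfl⟩⟩

/-- One inclusion is the pair of curve arguments; the other holds because the centre of a Morse
chart is critical. -/
theorem criticalSet_symProjSum (H : IsSymComplexStructure cs) :
    criticalSet k (symProjSum p k) =
      {z : Sym (DoubleCover p) k | (z : Multiset (DoubleCover p)).Nodup ∧
        ∀ w ∈ z, ∃ j : Fin n, w = branchPoint p j} := by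
  have := H.isManifold
  ext z
  obtain ⟨v, rfl⟩ := symMk_surjective z
  rw [mem_ofPred_eq, nodup_and_forall_branchPoint_iff]
  constructor
  · intro hv
    choose σ hσ using fun i => exists_eq_branchPoint (snd_eq_zero_of_mem_criticalSet H hv i)
    refine ⟨σ, fun i j hij => injective_of_mem_criticalSet H hv ?_, funext hσ⟩
    rw [hσ i, hσ j, hij]
  · rintro ⟨σ, hσ, rfl⟩
    obtain ⟨e, he, h1, h2, h3⟩ := exists_morse_chart H hσ
    exact mem_criticalSet_of_morse_chart he h1 h2 h3

theorem exists_morse_chart_of_mem_criticalSet (H : IsSymComplexStructure cs)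
    {z : Sym (DoubleCover p) k} (hz : z ∈ criticalSet k (symProjSum p k)) :
    ∃ e ∈ IsManifold.maximalAtlas 𝓘(ℂ, Fin k → ℂ) ω (Sym (DoubleCover p) k), z ∈ e.source ∧
      e z = 0 ∧ ∀ x ∈ e.source, symProjSum p k x = symProjSum p k z + ∑ i, e x i ^ 2 := by
  rw [criticalSet_symProjSum H] at hz
  obtain ⟨v, rfl⟩ := symMk_surjective z
  obtain ⟨σ, hσ, rfl⟩ := nodup_and_forall_branchPoint_iff.1 hz
  exact exists_morse_chart H hσ

variable (p k) in
/-- There are `n.choose k` tuples of pairwise distinct ramification points. -/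
theorem ncard_branchPoint_tuples :
    {z : Sym (DoubleCover p) k | (z : Multiset (DoubleCover p)).Nodup ∧
      ∀ w ∈ z, ∃ j : Fin n, w = branchPoint p j}.ncard = n.choose k := by
  have h : n.choose k = (Finset.powersetCard k (Finset.univ : Finset (Fin n))).card := by simp
  rw [h, ← Set.ncard_coe_finset]
  symm
  -- A `k`-element set of indices goes to the multiset of its ramification points.
  refine Set.ncard_congr (fun s hs => ⟨s.val.map (branchPoint p), by
    rw [Multiset.card_map]; exact (Finset.mem_powersetCard.1 hs).2⟩) ?_ ?_ ?_
  · intro s hs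
    refine ⟨s.nodup.map branchPoint_injective, fun w hw => ?_⟩
    obtain ⟨j, -, rfl⟩ := Multiset.mem_map.1 hw
    exact ⟨j, rfl⟩
  · intro s t hs ht hst
    exact Finset.val_injective (Multiset.map_injective branchPoint_injective
      (congrArg Subtype.val hst))
  · rintro z hz
    obtain ⟨v, rfl⟩ := symMk_surjective z
    obtain ⟨σ, hσ, rfl⟩ := nodup_and_forall_branchPoint_iff.1 hz
    refine ⟨Finset.univ.map ⟨σ, hσ⟩, by simp, Subtype.ext ?_⟩
    change (Finset.univ.map ⟨σ, hσ⟩).val.map (branchPoint p) =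
      Finset.univ.val.map fun i => branchPoint p (σ i)
    rw [Finset.map_val, Multiset.map_map]
    rfl

end Fibration

end

theorem mainTheorem7 (n k : ℕ) (hk : 1 ≤ k) (hkn : k ≤ n) (p : Fin n ↪ ℂ) :
    (∃ cs : ChartedSpace (Fin k → ℂ) (Sym (DoubleCover p) k), IsSymComplexStructure cs) ∧
    ∀ cs : ChartedSpace (Fin k → ℂ) (Sym (DoubleCover p) k), IsSymComplexStructure cs →
      IsLefschetzFibration k (symProjSum p k) ∧
      criticalSet k (symProjSum p k) =
        {z : Sym (DoubleCover p) k | (z : Multiset (DoubleCover p)).Nodup ∧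
          ∀ w ∈ z, ∃ j : Fin n, w = DoubleCover.branchPoint p j} ∧
      (criticalSet k (symProjSum p k)).ncard = n.choose k ∧
      ∀ z ∈ criticalSet k (symProjSum p k), IsNondegenerateCriticalPoint k (symProjSum p k) z := by
  refine ⟨⟨_, isSymComplexStructure_symChartedSpace (DoubleCover p) k⟩, fun cs H => ?_⟩
  have hM := H.isManifold
  have hcard : (criticalSet k (symProjSum p k)).ncard = n.choose k := by
    rw [criticalSet_symProjSum H, ncard_branchPoint_tuples]
  refine ⟨⟨hM, contMDiff_symProjSum H, symProjSum_surjective hk, ?_, fun z hz =>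
    exists_morse_chart_of_mem_criticalSet H hz⟩, criticalSet_symProjSum H, hcard, fun z hz => ?_⟩
  -- An infinite set has `ncard` zero, so a nonzero count proves finiteness; `k ≤ n` makes the
  -- binomial coefficient positive.
  · refine Set.finite_of_ncard_ne_zero ?_
    rw [hcard]
    exact (Nat.choose_pos hkn).ne'
  · obtain ⟨e, he, h1, h2, h3⟩ := exists_morse_chart_of_mem_criticalSet H hz
    exact isNondegenerateCriticalPoint_of_morse_chart he h1 h2 h3
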